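/- An instance $I$ of discrete Bamboo Garden Trimming (BGT) consists of $n\ge 2$ bamboos with positive real daily growth rates $h_1\ge h_2\ge\dots\ge h_n>0$; put $H=h_1+\dots+h_n$. A schedule $S=(i_1,i_2,\dots)$ is an infinite sequence of indices in $\{1,\dots,n\}$; bamboo $i_k$ is cut to height $0$ at time $k$ (the end of day $k$). The height of bamboo $i$ at time $t\ge 0$ is $(t-t')h_i$, where $t'$ is the last time at which it was cut by time $t$, or $t'=0$ if it has not been cut by then. Let $MH(S)$ be the supremum of the heights of all bamboos over all times $t\ge 0$, and let $OPT(I)$ be the infimum of $MH(S)$ over all schedules $S$. A Pinwheel instance is a sequence of integers $2\le f_1\le\dots\le f_n$; its density is $\sum_i 1/f_i$, and a schedule of it is an infinite sequence of indices in which any $f_i$ consecutive entries contain $i$, for each $i$. A polynomial-time BGT algorithm consists of a preprocessing program, run once, and a program that is then run repeatedly, each run computing the next index of the schedule, on a random access machine with unit-time arithmetic operations ($+,-,\cdot,/$), rounding down, comparisons and memory accesses on real numbers. On every input, the preprocessing takes time polynomial in $n$, and each further index takes time polylogarithmic in $n$. Moreover, if all growth rates are rational, then every number occurring up to the computation of the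 $t$-th index is rational with bit length polynomial in the bit size of the input and in $\log t$. **Lemma.** There is a polynomial-time BGT algorithm that on every instance $I$ of discrete BGT produces a schedule $S$ with $$MH(S)\le\Bigl(\frac43+\frac{h_1}{H}\Bigr)\,OPT(I).$$ More precisely, with $\delta=\frac13+\frac{h_1}{H}$ and $f_i=\lfloor (1+\delta)H/h_i\rfloor$, the sequence $(f_1,\dots,f_n)$ is a Pinwheel instance of density less than $3/4$, and the schedule $S$ produced by the algorithm is a schedule of this Pinwheel instance. -/

import Mathlib

noncomputable section

namespace BGT

/-! ### Discrete Bamboo Garden Trimming -/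

/-- An instance of discrete BGT: `n ≥ 2` bamboos with positive daily growth rates, arranged in
non-increasing order. The bamboos are numbered `0, …, n - 1`, so `rate 0` is `h₁`. -/
structure Instance (n : ℕ) where
  two_le : 2 ≤ n
  rate : Fin n → ℝ
  rate_pos : ∀ i, 0 < rate i
  rate_anti : Antitone rate

namespace Instance

variable {n : ℕ}

/-- The largest growth rate `h₁`. -/
def h₁ (I : Instance n) : ℝ := I.rate ⟨0, lt_of_lt_of_le Nat.zero_lt_two I.two_le⟩

/-- The sum `H = h₁ + ⋯ + hₙ` of the growth rates. -/
def H (I : Instance n) : ℝ := ∑ i, I.rate i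

end Instance

/-- A perpetual schedule: `S k` is the bamboo cut at time `k + 1`, the end of day `k + 1`. -/
abbrev Schedule (n : ℕ) : Type := ℕ → Fin n

/-- The last time `≤ t` at which bamboo `i` was cut, or `0` if it has not been cut by time `t`. -/
def lastCut {n : ℕ} (S : Schedule n) (i : Fin n) (t : ℝ) : ℕ :=
  ((Finset.range ⌊t⌋₊).filter (fun k => S k = i)).sup (fun k => k + 1)

/-- The height of bamboo `i` at time `t`. -/
def height {n : ℕ} (I : Instance n) (S : Schedule n) (i : Fin n) (t : ℝ) : ℝ :=
  (t - lastCut S i t) * I.rate i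

/-- `MH(S)`: the supremum of the heights of the bamboos over all real times `t ≥ 0`
(possibly infinite). -/
def MH {n : ℕ} (I : Instance n) (S : Schedule n) : ENNReal :=
  ⨆ (i : Fin n) (t : ℝ) (_ : 0 ≤ t), ENNReal.ofReal (height I S i t)

/-- `OPT(I)`: the infimum of `MH(S)` over all schedules. -/
def OPT {n : ℕ} (I : Instance n) : ENNReal := ⨅ S : Schedule n, MH I S

/-! ### Pinwheel scheduling -/

/-- Instances of Pinwheel: integers `2 ≤ f₁ ≤ f₂ ≤ ⋯ ≤ fₙ`. -/
def IsPinwheelInstance {n : ℕ} (f : Fin n → ℕ) : Prop :=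
  (∀ i, 2 ≤ f i) ∧ Monotone f

/-- The density `∑ 1 / fᵢ` of a Pinwheel instance. -/
def density {n : ℕ} (f : Fin n → ℕ) : ℝ := ∑ i, 1 / (f i : ℝ)

/-- `S` is a schedule of the Pinwheel instance `f`: any `fᵢ` consecutive entries of `S` contain
`i`. -/
def IsPinwheelSchedule {n : ℕ} (f : Fin n → ℕ) (S : Schedule n) : Prop :=
  ∀ (i : Fin n) (m : ℕ), ∃ k, m ≤ k ∧ k < m + f i ∧ S k = i

/-- The frequencies `fᵢ = ⌊(1 + δ) H / hᵢ⌋`. -/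
def roundedFrequencies {n : ℕ} (I : Instance n) (δ : ℝ) (i : Fin n) : ℕ :=
  ⌊(1 + δ) * I.H / I.rate i⌋₊

/-! ### The machine model

A random access machine over the real numbers, given by structured programs. The memory consists
of arrays, numbered by natural numbers, of cells holding real numbers. Each arithmetic operation,
rounding, comparison and memory access takes unit time. The set of values that may
occur during an execution is controlled by a predicate `ok`; it is used to bound the bit lengths
of all numbers when the input is rational. -/

/-- The memory: `m a j` is the content of cell `j` of array `a`. -/
abbrev Mem : Type := ℕ → ℕ → ℝ

/-- Expressions. `get a e` is the content of cell `⌊e⌋` of array `a`. -/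
inductive Expr : Type
  | const (q : ℚ)
  | get (a : ℕ) (e : Expr)
  | add (e₁ e₂ : Expr)
  | sub (e₁ e₂ : Expr)
  | mul (e₁ e₂ : Expr)
  | div (e₁ e₂ : Expr)
  | floor (e : Expr)

namespace Expr

/-- The value of an expression. -/
def eval (m : Mem) : Expr → ℝ
  | const q => (q : ℝ)
  | get a e => m a ⌊e.eval m⌋₊
  | add e₁ e₂ => e₁.eval m + e₂.eval m
  | sub e₁ e₂ => e₁.eval m - e₂.eval m
  | mul e₁ e₂ => e₁.eval m * e₂.eval m
  | div e₁ e₂ => e₁.eval m / e₂.eval m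
  | floor e => (⌊e.eval m⌋ : ℝ)

/-- The time to evaluate an expression: one unit for each node. -/
def cost : Expr → ℕ
  | const _ => 1
  | get _ e => e.cost + 1
  | add e₁ e₂ => e₁.cost + e₂.cost + 1
  | sub e₁ e₂ => e₁.cost + e₂.cost + 1
  | mul e₁ e₂ => e₁.cost + e₂.cost + 1
  | div e₁ e₂ => e₁.cost + e₂.cost + 1
  | floor e => e.cost + 1

/-- Every value computed during the evaluation of the expression satisfies `ok`. -/
def AllOk (ok : ℝ → Prop) (m : Mem) : Expr → Prop
  | const q => ok ((const q).eval m)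
  | get a e => e.AllOk ok m ∧ ok ((get a e).eval m)
  | add e₁ e₂ => e₁.AllOk ok m ∧ e₂.AllOk ok m ∧ ok ((add e₁ e₂).eval m)
  | sub e₁ e₂ => e₁.AllOk ok m ∧ e₂.AllOk ok m ∧ ok ((sub e₁ e₂).eval m)
  | mul e₁ e₂ => e₁.AllOk ok m ∧ e₂.AllOk ok m ∧ ok ((mul e₁ e₂).eval m)
  | div e₁ e₂ => e₁.AllOk ok m ∧ e₂.AllOk ok m ∧ ok ((div e₁ e₂).eval m)
  | floor e => e.AllOk ok m ∧ ok ((floor e).eval m)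

end Expr

/-- Programs. `assign a j e` writes the value of `e` to cell `⌊j⌋` of array `a`; the tests of
`ifLt e₁ e₂ _ _` and `whileLt e₁ e₂ _` are `e₁ < e₂`. -/
inductive Prog : Type
  | skip
  | assign (a : ℕ) (j e : Expr)
  | seq (p₁ p₂ : Prog)
  | ifLt (e₁ e₂ : Expr) (p₁ p₂ : Prog)
  | whileLt (e₁ e₂ : Expr) (p : Prog)

/-- The memory after writing `x` to cell `j` of array `a`. -/
def Mem.write (m : Mem) (a j : ℕ) (x : ℝ) : Mem :=
  Function.update m a (Function.update (m a) j x)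

/-- `Exec ok p m m' k`: started on memory `m`, the program `p` halts after `k` time units with
memory `m'`, and every value computed on the way satisfies `ok`. -/
inductive Exec (ok : ℝ → Prop) : Prog → Mem → Mem → ℕ → Prop
  | skip (m : Mem) : Exec ok Prog.skip m m 1
  | assign (m : Mem) (a : ℕ) (j e : Expr) (hj : j.AllOk ok m) (he : e.AllOk ok m) :
      Exec ok (Prog.assign a j e) m (m.write a ⌊j.eval m⌋₊ (e.eval m)) (j.cost + e.cost + 1)
  | seq {p₁ p₂ : Prog} {m m' m'' : Mem} {k₁ k₂ : ℕ}
      (h₁ : Exec ok p₁ m m' k₁) (h₂ : Exec ok p₂ m' m'' k₂) :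
      Exec ok (Prog.seq p₁ p₂) m m'' (k₁ + k₂)
  | ifTrue {e₁ e₂ : Expr} {p₁ p₂ : Prog} {m m' : Mem} {k : ℕ}
      (h₁ : e₁.AllOk ok m) (h₂ : e₂.AllOk ok m) (ht : e₁.eval m < e₂.eval m)
      (h : Exec ok p₁ m m' k) :
      Exec ok (Prog.ifLt e₁ e₂ p₁ p₂) m m' (e₁.cost + e₂.cost + 1 + k)
  | ifFalse {e₁ e₂ : Expr} {p₁ p₂ : Prog} {m m' : Mem} {k : ℕ}
      (h₁ : e₁.AllOk ok m) (h₂ : e₂.AllOk ok m) (ht : ¬ e₁.eval m < e₂.eval m)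
      (h : Exec ok p₂ m m' k) :
      Exec ok (Prog.ifLt e₁ e₂ p₁ p₂) m m' (e₁.cost + e₂.cost + 1 + k)
  | whileTrue {e₁ e₂ : Expr} {p : Prog} {m m' m'' : Mem} {k k' : ℕ}
      (h₁ : e₁.AllOk ok m) (h₂ : e₂.AllOk ok m) (ht : e₁.eval m < e₂.eval m)
      (h : Exec ok p m m' k) (hw : Exec ok (Prog.whileLt e₁ e₂ p) m' m'' k') :
      Exec ok (Prog.whileLt e₁ e₂ p) m m'' (e₁.cost + e₂.cost + 1 + k + k')
  | whileFalse {e₁ e₂ : Expr} {p : Prog} {m : Mem}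
      (h₁ : e₁.AllOk ok m) (h₂ : e₂.AllOk ok m) (ht : ¬ e₁.eval m < e₂.eval m) :
      Exec ok (Prog.whileLt e₁ e₂ p) m m (e₁.cost + e₂.cost + 1)

/-- `x` is a rational number whose reduced numerator and denominator have together at most `B`
binary digits. -/
def HasBits (B : ℕ) (x : ℝ) : Prop :=
  ∃ q : ℚ, (q : ℝ) = x ∧ Nat.size q.num.natAbs + Nat.size q.den ≤ B

/-! ### Algorithms for discrete BGT -/

/-- An algorithm for discrete BGT: a preprocessing program, run once, and a program that is then
run again and again, each run computing the next index of the schedule. -/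
structure Algorithm where
  preprocess : Prog
  next : Prog

/-- The initial memory: array `0` holds `n` (in its cell `0`), array `1` holds the growth rates,
and all other cells are `0`. -/
def inputMem {n : ℕ} (I : Instance n) : Mem := fun a j =>
  if a = 0 ∧ j = 0 then (n : ℝ)
  else if hj : a = 1 ∧ j < n then I.rate ⟨j, hj.2⟩
  else 0

/-- On input `I`, the algorithm produces the schedule `S`: after each run of `next`, cell `0` of
array `2` holds the next entry of `S`. The preprocessing takes `k 0` time units and the computation
of the entry `S t` takes `k (t + 1)` time units. Every value computed in these phases satisfies
`ok 0` and `ok (t + 1)` respectively. -/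
def Algorithm.Runs {n : ℕ} (A : Algorithm) (I : Instance n) (S : Schedule n)
    (ok : ℕ → ℝ → Prop) (k : ℕ → ℕ) : Prop :=
  ∃ m : ℕ → Mem,
    Exec (ok 0) A.preprocess (inputMem I) (m 0) (k 0) ∧
    ∀ t, Exec (ok (t + 1)) A.next (m t) (m (t + 1)) (k (t + 1)) ∧
      m (t + 1) 2 0 = ((S t : ℕ) : ℝ)

/-- On input `I`, the algorithm produces the schedule `S`. -/
def Algorithm.Outputs {n : ℕ} (A : Algorithm) (I : Instance n) (S : Schedule n) : Prop :=
  ∃ k : ℕ → ℕ, A.Runs I S (fun _ _ => True) k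

/-- The size of a rational input: the number of binary digits of all numerators and
denominators. -/
def inputSize {n : ℕ} (q : Fin n → ℚ) : ℕ :=
  ∑ i, (Nat.size (q i).num.natAbs + Nat.size (q i).den)

/-- Polynomial-time BGT algorithms: on every input, the algorithm produces a schedule with
preprocessing time polynomial in `n` and time polylogarithmic in `n` for each further index; and if
the growth rates are rational, then all numbers that occur are rational, with bit length polynomial
in the input size and the bit length of the current day. -/
def Algorithm.IsPolynomialTime (A : Algorithm) : Prop :=
  ∃ c : ℕ, ∀ (n : ℕ) (I : Instance n), ∃ (S : Schedule n) (k : ℕ → ℕ),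
    A.Runs I S (fun _ _ => True) k ∧
    k 0 ≤ c * n ^ c ∧
    (∀ t, k (t + 1) ≤ c * (Nat.log 2 n + 1) ^ c) ∧
    ∀ q : Fin n → ℚ, (∀ i, (q i : ℝ) = I.rate i) →
      A.Runs I S (fun t => HasBits (c * (inputSize q + Nat.size t) ^ c)) k

end BGT

end

/-!
Each day adds `H` to the total height and each cut removes at most the maximal height, so `H ≤ OPT`.
A Pinwheel schedule for the periods `⌊c / hᵢ⌋`, where `c = (1 + δ) H = 4 H / 3 + h₁`, keeps all
heights at most `c`, so it remains to find one fast.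

Give bamboo `i` the weight `hᵢ / c`, raised to `1 / (1000 n)` if it is smaller. Two trees of weights
`a ≤ b` that take turns alternately become a tree of weight `2 b`; the two lightest trees are merged
as long as the result is at most `1 / L`, where `L` is `⌊c / h₁⌋` up to rounding. Such a merge adds
`b - a` to the total weight, so the total excess never exceeds the least weight. The remaining trees
are packed greedily, in descending order, into `p` bins served in turn, where all trees of a bin are
served as often as its heaviest tree requires. Since only the last tree has weight below `1 / (2 L)`
and the total weight is less than about `3 / 4`, the bins suffice.

The lower bound on the weights makes the trees of logarithmic height, so that the bamboo to be cut
on a given day is found by walking down a tree along the binary digits of the number of the turn.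
Bit lengths stay short because every stored number is a natural number, a rate, a partial sum of the
rates, `c`, or a power of two times an initial weight.
-/

namespace BGT

/-! ### Heights and Pinwheel schedules -/

section Heights

variable {n : ℕ} (I : Instance n)

namespace Instance

lemma rate_le_h₁ (i : Fin n) : I.rate i ≤ I.h₁ := I.rate_anti (Fin.mk_le_of_le_val (Nat.zero_le _))

lemma h₁_pos : 0 < I.h₁ := I.rate_pos _

lemma h₁_le_H : I.h₁ ≤ I.H :=
  Finset.single_le_sum (fun j _ => (I.rate_pos j).le) (Finset.mem_univ _)

lemma H_pos : 0 < I.H := I.h₁_pos.trans_le I.h₁_le_H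

end Instance

theorem isPinwheelInstance_roundedFrequencies {δ : ℝ} (hδ : 2 * I.h₁ ≤ (1 + δ) * I.H) :
    IsPinwheelInstance (roundedFrequencies I δ) := by
  have h₁_pos := I.h₁_pos
  refine ⟨fun i => Nat.le_floor ?_, fun i j hij => Nat.floor_mono ?_⟩
  · rw [le_div_iff₀ (I.rate_pos i)]
    have := I.rate_le_h₁ i
    push_cast
    linarith
  · exact div_le_div_of_nonneg_left (by linarith) (I.rate_pos j) (I.rate_anti hij)

theorem density_roundedFrequencies_lt {δ : ℝ} (hδ : I.h₁ < (1 + δ) * I.H) :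
    density (roundedFrequencies I δ) < I.H / ((1 + δ) * I.H - I.h₁) := by
  have inv_lt : ∀ i ∈ Finset.univ,
      1 / (roundedFrequencies I δ i : ℝ) < I.rate i / ((1 + δ) * I.H - I.h₁) := by
    intro i _
    have rate_pos := I.rate_pos i
    have lt_floor : ((1 + δ) * I.H - I.h₁) / I.rate i < roundedFrequencies I δ i := by
      refine lt_of_le_of_lt ?_ (Nat.sub_one_lt_floor _)
      rw [div_sub_one rate_pos.ne', div_le_div_iff_of_pos_right rate_pos]
      exact sub_le_sub_left (I.rate_le_h₁ i) _
    rw [← one_div_div (_ - _)]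
    exact one_div_lt_one_div_of_lt (div_pos (sub_pos.mpr hδ) rate_pos) lt_floor
  have := Fin.pos_iff_nonempty.mp (Nat.zero_lt_two.trans_le I.two_le)
  rw [Instance.H, Finset.sum_div]
  exact Finset.sum_lt_sum_of_nonempty Finset.univ_nonempty inv_lt

lemma sub_lastCut_le {f : Fin n → ℕ} {S : Schedule n} (hS : IsPinwheelSchedule f S) (i : Fin n)
    (t : ℝ) : t - lastCut S i t ≤ f i := by
  by_contra! h
  obtain ⟨k, le_k, k_lt, cut⟩ := hS i (lastCut S i t)
  have le_floor : lastCut S i t + f i ≤ ⌊t⌋₊ := Nat.le_floor (by push_cast; linarith)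
  have succ_le : k + 1 ≤ lastCut S i t :=
    Finset.le_sup (f := (· + 1))
      (Finset.mem_filter.mpr ⟨Finset.mem_range.mpr (k_lt.trans_le le_floor), cut⟩)
  omega

theorem MH_le_of_isPinwheelSchedule {δ : ℝ} (hδ : 0 ≤ 1 + δ) {S : Schedule n}
    (hS : IsPinwheelSchedule (roundedFrequencies I δ) S) :
    MH I S ≤ ENNReal.ofReal ((1 + δ) * I.H) := by
  refine iSup_le fun i => iSup_le fun t => iSup_le fun _ => ENNReal.ofReal_le_ofReal ?_
  rw [height, ← le_div_iff₀ (I.rate_pos i)]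
  exact (sub_lastCut_le hS i t).trans
    (Nat.floor_le (div_nonneg (mul_nonneg hδ I.H_pos.le) (I.rate_pos i).le))

lemma lastCut_natCast_add (S : Schedule n) (i : Fin n) (k : ℕ) {s : ℝ} (hs₀ : 0 ≤ s)
    (hs₁ : s < 1) : lastCut S i (k + s) = lastCut S i k := by
  have : ⌊(k : ℝ) + s⌋₊ = k := by
    rw [Nat.floor_eq_iff (by positivity)]
    constructor <;> linarith
  rw [lastCut, this, lastCut, Nat.floor_natCast]

lemma lastCut_succ_self (S : Schedule n) (k : ℕ) : lastCut S (S k) (k + 1 : ℕ) = k + 1 := by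
  rw [lastCut, Nat.floor_natCast]
  refine le_antisymm (Finset.sup_le fun j hj => ?_) ?_
  · exact Finset.mem_range.mp (Finset.mem_filter.mp hj).1
  · exact Finset.le_sup (f := (· + 1)) (Finset.mem_filter.mpr ⟨by simp, rfl⟩)

lemma lastCut_succ_of_ne {S : Schedule n} {k : ℕ} {i : Fin n} (h : S k ≠ i) :
    lastCut S i (k + 1 : ℕ) = lastCut S i k := by
  rw [lastCut, lastCut, Nat.floor_natCast, Nat.floor_natCast, Finset.range_add_one,
    Finset.filter_insert, if_neg h]

lemma height_zero (S : Schedule n) (i : Fin n) : height I S i 0 = 0 := by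
  simp [height, lastCut]

lemma sum_height_succ (S : Schedule n) (k : ℕ) :
    ∑ i, height I S i (k + 1 : ℕ)
      = ∑ i, height I S i k + I.H - (height I S (S k) k + I.rate (S k)) := by
  have height_succ : ∀ i, height I S i (k + 1 : ℕ) = height I S i k + I.rate i
      - if i = S k then height I S i k + I.rate i else 0 := by
    intro i
    split_ifs with h
    · subst h
      simp only [height, lastCut_succ_self, sub_self, zero_mul]
    · simp only [height, lastCut_succ_of_ne (Ne.symm h)]
      push_cast
      ring
  rw [Finset.sum_congr rfl fun i _ => height_succ i, Finset.sum_sub_distrib,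
    Finset.sum_add_distrib, Finset.sum_ite_eq', if_pos (Finset.mem_univ _), Instance.H]

section LowerBound

variable {I} {S : Schedule n} {M : ℝ}

lemma height_add_rate_le (hM : ∀ i t, 0 ≤ t → height I S i t ≤ M) (i : Fin n) (k : ℕ) :
    height I S i k + I.rate i ≤ M := by
  by_contra! hlt
  have rate_pos := I.rate_pos i
  -- Just before time `k + 1` the bamboo has height almost `height I S i k + I.rate i`.
  set s := ((M - height I S i k) / I.rate i + 1) / 2 with s_def
  have quot_nonneg : 0 ≤ (M - height I S i k) / I.rate i :=
    div_nonneg (sub_nonneg.mpr (hM i k k.cast_nonneg)) rate_pos.le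
  have quot_lt : (M - height I S i k) / I.rate i < 1 := by
    rw [div_lt_one rate_pos]; linarith
  have mul_rate : s * I.rate i = (M - height I S i k + I.rate i) / 2 := by
    rw [s_def]; field_simp
  have le_M := hM i (k + s) (by positivity)
  have height_eq : height I S i (k + s) = height I S i k + s * I.rate i := by
    rw [height, lastCut_natCast_add S i k (by positivity) (by linarith), height]
    ring
  linarith

lemma mul_sub_le_sum_height (hM : ∀ i t, 0 ≤ t → height I S i t ≤ M) (k : ℕ) :
    k * (I.H - M) ≤ ∑ i, height I S i k := by
  induction k with
  | zero => simp only [Nat.cast_zero, height_zero, zero_mul, Finset.sum_const_zero, le_refl]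
  | succ k ih =>
    rw [sum_height_succ]
    have := height_add_rate_le hM (S k) k
    push_cast
    linarith

/-- A day adds `H` to the total height and the cut removes at most `M`, so the total height would
grow without bound if `M < H`. -/
theorem H_le_of_forall_height_le (hM : ∀ i t, 0 ≤ t → height I S i t ≤ M) : I.H ≤ M := by
  by_contra! hlt
  obtain ⟨k, hk⟩ := exists_nat_gt (n * M / (I.H - M))
  rw [div_lt_iff₀ (sub_pos.mpr hlt)] at hk
  have sum_le : ∑ i, height I S i (k : ℝ) ≤ ∑ _i : Fin n, M :=
    Finset.sum_le_sum fun i _ => hM i k k.cast_nonneg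
  rw [Finset.sum_const, Finset.card_univ, Fintype.card_fin, nsmul_eq_mul] at sum_le
  linarith [mul_sub_le_sum_height hM k]

end LowerBound

theorem ofReal_H_le_OPT : ENNReal.ofReal I.H ≤ OPT I := by
  refine le_iInf fun S => ?_
  rcases eq_or_ne (MH I S) ⊤ with h | h
  · rw [h]; exact le_top
  refine ENNReal.ofReal_le_of_le_toReal (H_le_of_forall_height_le (S := S) fun i t ht => ?_)
  exact (ENNReal.ofReal_le_iff_le_toReal h).mp
    (le_iSup_of_le i (le_iSup_of_le t (le_iSup_of_le ht le_rfl)))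

theorem MH_le_mul_OPT {δ : ℝ} (hδ : 0 ≤ 1 + δ) {S : Schedule n}
    (hS : IsPinwheelSchedule (roundedFrequencies I δ) S) :
    MH I S ≤ ENNReal.ofReal (1 + δ) * OPT I := calc
  MH I S ≤ ENNReal.ofReal ((1 + δ) * I.H) := MH_le_of_isPinwheelSchedule I hδ hS
  _ = ENNReal.ofReal (1 + δ) * ENNReal.ofReal I.H := ENNReal.ofReal_mul hδ
  _ ≤ ENNReal.ofReal (1 + δ) * OPT I := by gcongr; exact ofReal_H_le_OPT I

end Heights

/-! ### Executions of programs -/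

lemma Expr.AllOk.mono {ok ok' : ℝ → Prop} {m : Mem} {e : Expr} (he : e.AllOk ok m)
    (h : ∀ x, ok x → ok' x) : e.AllOk ok' m := by
  induction e with
  | const q => exact h _ he
  | get _ _ ih | floor _ ih => exact ⟨ih he.1, h _ he.2⟩
  | add _ _ ih₁ ih₂ | sub _ _ ih₁ ih₂ | mul _ _ ih₁ ih₂ | div _ _ ih₁ ih₂ =>
    exact ⟨ih₁ he.1, ih₂ he.2.1, h _ he.2.2⟩

lemma Exec.mono {ok ok' : ℝ → Prop} {p : Prog} {m m' : Mem} {k : ℕ} (hp : Exec ok p m m' k)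
    (h : ∀ x, ok x → ok' x) : Exec ok' p m m' k := by
  induction hp with
  | skip m => exact .skip m
  | assign m a j e hj he => exact .assign m a j e (hj.mono h) (he.mono h)
  | seq _ _ ih₁ ih₂ => exact .seq ih₁ ih₂
  | ifTrue h₁ h₂ hlt _ ih => exact .ifTrue (h₁.mono h) (h₂.mono h) hlt ih
  | ifFalse h₁ h₂ hlt _ ih => exact .ifFalse (h₁.mono h) (h₂.mono h) hlt ih
  | whileTrue h₁ h₂ hlt _ _ ih₁ ih₂ => exact .whileTrue (h₁.mono h) (h₂.mono h) hlt ih₁ ih₂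
  | whileFalse h₁ h₂ hlt => exact .whileFalse (h₁.mono h) (h₂.mono h) hlt

lemma Exec.unique {ok ok' : ℝ → Prop} {p : Prog} {m m₁ m₂ : Mem} {k₁ k₂ : ℕ}
    (h₁ : Exec ok p m m₁ k₁) (h₂ : Exec ok' p m m₂ k₂) : m₁ = m₂ ∧ k₁ = k₂ := by
  induction h₁ generalizing m₂ k₂ with
  | skip | assign =>
    cases h₂
    exact ⟨rfl, rfl⟩
  | seq _ _ ih₁ ih₂ =>
    cases h₂ with
    | seq exec₁ exec₂ =>
      obtain ⟨rfl, rfl⟩ := ih₁ exec₁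
      obtain ⟨rfl, rfl⟩ := ih₂ exec₂
      exact ⟨rfl, rfl⟩
  | ifTrue _ _ hlt _ ih =>
    cases h₂ with
    | ifTrue _ _ _ exec =>
      obtain ⟨rfl, rfl⟩ := ih exec
      exact ⟨rfl, rfl⟩
    | ifFalse _ _ not_lt _ => exact absurd hlt not_lt
  | ifFalse _ _ not_lt _ ih =>
    cases h₂ with
    | ifFalse _ _ _ exec =>
      obtain ⟨rfl, rfl⟩ := ih exec
      exact ⟨rfl, rfl⟩
    | ifTrue _ _ hlt _ => exact absurd hlt not_lt
  | whileTrue _ _ hlt _ _ ih₁ ih₂ =>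
    cases h₂ with
    | whileTrue _ _ _ exec₁ exec₂ =>
      obtain ⟨rfl, rfl⟩ := ih₁ exec₁
      obtain ⟨rfl, rfl⟩ := ih₂ exec₂
      exact ⟨rfl, rfl⟩
    | whileFalse _ _ not_lt => exact absurd hlt not_lt
  | whileFalse _ _ not_lt =>
    cases h₂ with
    | whileFalse _ _ _ => exact ⟨rfl, rfl⟩
    | whileTrue _ _ hlt _ _ => exact absurd hlt not_lt

lemma Algorithm.Runs.mono {n : ℕ} {A : Algorithm} {I : Instance n} {S : Schedule n}
    {ok ok' : ℕ → ℝ → Prop} {k : ℕ → ℕ} (hA : A.Runs I S ok k) (h : ∀ t x, ok t x → ok' t x) :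
    A.Runs I S ok' k := by
  obtain ⟨m, hpre, hnext⟩ := hA
  exact ⟨m, hpre.mono (h 0), fun t => ⟨(hnext t).1.mono (h (t + 1)), (hnext t).2⟩⟩

lemma Algorithm.Runs.unique {n : ℕ} {A : Algorithm} {I : Instance n} {S S' : Schedule n}
    {ok ok' : ℕ → ℝ → Prop} {k k' : ℕ → ℕ} (hS : A.Runs I S ok k) (hS' : A.Runs I S' ok' k') :
    S = S' := by
  obtain ⟨m, hpre, hnext⟩ := hS
  obtain ⟨m', hpre', hnext'⟩ := hS'
  have mem_eq : ∀ t, m t = m' t := by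
    intro t
    induction t with
    | zero => exact (hpre.unique hpre').1
    | succ t ih => exact ((ih ▸ (hnext t).1).unique (hnext' t).1).1
  funext t
  have entry_eq := (hnext t).2
  rw [mem_eq, (hnext' t).2] at entry_eq
  exact Fin.ext (by exact_mod_cast entry_eq.symm)

/-- Started on `m`, the program `p` halts within `k` time units in a memory satisfying `Q`, and
every value computed on the way satisfies `ok`. -/
def Reaches (ok : ℝ → Prop) (p : Prog) (m : Mem) (k : ℕ) (Q : Mem → Prop) : Prop :=
  ∃ m' k', Exec ok p m m' k' ∧ k' ≤ k ∧ Q m'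

namespace Reaches

variable {ok : ℝ → Prop} {p p₁ p₂ : Prog} {e₁ e₂ : Expr} {m : Mem} {k k₁ k₂ : ℕ}
  {Q R : Mem → Prop}

lemma mono (h : Reaches ok p m k₁ R) (hk : k₁ ≤ k) (hQ : ∀ m', R m' → Q m') :
    Reaches ok p m k Q := by
  obtain ⟨m', k', exec, hk', hR⟩ := h
  exact ⟨m', k', exec, hk'.trans hk, hQ m' hR⟩

lemma seq (hk : k₁ + k₂ ≤ k) (h₁ : Reaches ok p₁ m k₁ R)
    (h₂ : ∀ m', R m' → Reaches ok p₂ m' k₂ Q) : Reaches ok (.seq p₁ p₂) m k Q := by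
  obtain ⟨m', k', exec₁, hk', hR⟩ := h₁
  obtain ⟨m'', k'', exec₂, hk'', hQ⟩ := h₂ m' hR
  exact ⟨m'', _, .seq exec₁ exec₂, by omega, hQ⟩

/-- The first argument of the invariant `J` bounds the number of remaining iterations. -/
lemma whileLt (J : ℕ → Mem → Prop) (b : ℕ) {i : ℕ}
    (hok : ∀ i m, J i m → e₁.AllOk ok m ∧ e₂.AllOk ok m)
    (hbody : ∀ i m, J i m → e₁.eval m < e₂.eval m → ∃ i', i = i' + 1 ∧ Reaches ok p m b (J i'))
    (hexit : ∀ i m, J i m → e₂.eval m ≤ e₁.eval m → Q m) (hJ : J i m)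
    (hk : (i + 1) * (e₁.cost + e₂.cost + 1 + b) ≤ k) : Reaches ok (.whileLt e₁ e₂ p) m k Q := by
  suffices Reaches ok (.whileLt e₁ e₂ p) m ((i + 1) * (e₁.cost + e₂.cost + 1 + b)) Q from
    this.mono hk fun _ => id
  clear hk
  induction i generalizing m with
  | zero =>
    have not_lt : ¬ e₁.eval m < e₂.eval m := fun hlt => by
      obtain ⟨i', hi', -⟩ := hbody _ _ hJ hlt
      omega
    obtain ⟨ok₁, ok₂⟩ := hok _ _ hJ
    exact ⟨m, _, .whileFalse ok₁ ok₂ not_lt, by omega, hexit _ _ hJ (le_of_not_gt not_lt)⟩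
  | succ i ih =>
    obtain ⟨ok₁, ok₂⟩ := hok _ _ hJ
    by_cases hlt : e₁.eval m < e₂.eval m
    · obtain ⟨i', hi', m', k', exec, hk', hJ'⟩ := hbody _ _ hJ hlt
      obtain rfl : i' = i := by omega
      obtain ⟨m'', k'', execs, hk'', hQ⟩ := ih hJ'
      refine ⟨m'', _, .whileTrue ok₁ ok₂ hlt exec execs, ?_, hQ⟩
      rw [Nat.succ_mul (i' + 1)]
      omega
    · refine ⟨m, _, .whileFalse ok₁ ok₂ hlt, ?_, hexit _ _ hJ (le_of_not_gt hlt)⟩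
      rw [Nat.succ_mul]
      omega

end Reaches

lemma Mem.write_apply (m : Mem) (a j : ℕ) (x : ℝ) (a' j' : ℕ) :
    m.write a j x a' j' = if a' = a ∧ j' = j then x else m a' j' := by
  by_cases ha : a' = a
  · subst ha
    simp [Mem.write, Function.update_apply]
  · simp [Mem.write, ha]

lemma Mem.forall_write {P : ℝ → Prop} {m : Mem} (hm : ∀ a j, P (m a j)) {x : ℝ} (hx : P x)
    (a j : ℕ) : ∀ a' j', P (m.write a j x a' j') := by
  intro a' j'
  rw [Mem.write_apply]
  split_ifs
  exacts [hx, hm _ _]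

/-! ### Bit lengths -/

lemma size_le_self (a : ℕ) : Nat.size a ≤ a := Nat.size_le.mpr a.lt_two_pow_self

lemma size_mul_le (a b : ℕ) : Nat.size (a * b) ≤ Nat.size a + Nat.size b := by
  rw [Nat.size_le, pow_add]
  exact Nat.mul_lt_mul'' (Nat.lt_size_self a) (Nat.lt_size_self b)

lemma size_add_le {a b k : ℕ} (ha : Nat.size a ≤ k) (hb : Nat.size b ≤ k) :
    Nat.size (a + b) ≤ k + 1 := by
  rw [Nat.size_le] at *
  rw [pow_succ]
  omega

lemma HasBits.mono {A B : ℕ} {x : ℝ} (hx : HasBits A x) (h : A ≤ B) : HasBits B x := by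
  obtain ⟨q, hq, size_le⟩ := hx
  exact ⟨q, hq, size_le.trans h⟩

/-- `x` is a quotient, not necessarily reduced, of integers with at most `A` binary digits each.
Under addition the bound grows additively, whereas the sum of the two bit lengths, on which
`HasBits` is based, would double. -/
def IsFrac (A : ℕ) (x : ℝ) : Prop :=
  ∃ (a : ℤ) (b : ℕ), b ≠ 0 ∧ x = a / b ∧ Nat.size a.natAbs ≤ A ∧ Nat.size b ≤ A

namespace IsFrac

variable {A B : ℕ} {x y : ℝ}

lemma mono (hx : IsFrac A x) (h : A ≤ B) : IsFrac B x := by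
  obtain ⟨a, b, hb, rfl, size_a, size_b⟩ := hx
  exact ⟨a, b, hb, rfl, size_a.trans h, size_b.trans h⟩

lemma one_le (hx : IsFrac A x) : 1 ≤ A := by
  obtain ⟨a, b, hb, rfl, -, size_b⟩ := hx
  exact (Nat.size_pos.mpr (Nat.pos_of_ne_zero hb)).trans_le size_b

lemma hasBits (hx : IsFrac A x) : HasBits (2 * A) x := by
  obtain ⟨a, b, hb, rfl, size_a, size_b⟩ := hx
  have num_le : (Rat.divInt a b).num.natAbs ≤ a.natAbs := by
    rcases eq_or_ne a 0 with rfl | ha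
    · simp
    · exact Nat.le_of_dvd (Int.natAbs_pos.mpr ha)
        (Int.natAbs_dvd_natAbs.mpr (Rat.num_dvd a (by exact_mod_cast hb)))
  have den_le : (Rat.divInt a b).den ≤ b :=
    Nat.le_of_dvd (Nat.pos_of_ne_zero hb) (by exact_mod_cast Rat.den_dvd a b)
  refine ⟨Rat.divInt a b, by rw [Rat.divInt_eq_div]; push_cast; rfl, ?_⟩
  have := Nat.size_le_size num_le
  have := Nat.size_le_size den_le
  omega

lemma ratCast {q : ℚ} (hnum : Nat.size q.num.natAbs ≤ A) (hden : Nat.size q.den ≤ A) :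
    IsFrac A q :=
  ⟨q.num, q.den, q.den_ne_zero, Rat.cast_def q, hnum, hden⟩

lemma natCast {k : ℕ} (hk : Nat.size k ≤ A) (hA : 1 ≤ A) : IsFrac A (k : ℝ) :=
  ⟨k, 1, one_ne_zero, by simp, by simpa using hk, by simpa using hA⟩

lemma mul (hx : IsFrac A x) (hy : IsFrac B y) : IsFrac (A + B) (x * y) := by
  obtain ⟨a, b, hb, rfl, size_a, size_b⟩ := hx
  obtain ⟨c, d, hd, rfl, size_c, size_d⟩ := hy
  refine ⟨a * c, b * d, mul_ne_zero hb hd, by push_cast; rw [div_mul_div_comm], ?_, ?_⟩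
  · rw [Int.natAbs_mul]
    exact (size_mul_le _ _).trans (add_le_add size_a size_c)
  · exact (size_mul_le _ _).trans (add_le_add size_b size_d)

lemma inv (hx : IsFrac A x) : IsFrac A x⁻¹ := by
  rcases eq_or_ne x 0 with rfl | hx₀
  · rwa [inv_zero]
  obtain ⟨a, b, -, rfl, size_a, size_b⟩ := hx
  have ha : a ≠ 0 := by rintro rfl; simp at hx₀
  refine ⟨a.sign * b, a.natAbs, Int.natAbs_ne_zero.mpr ha, ?_, ?_, size_a⟩
  · have ha' : (a : ℝ) ≠ 0 := Int.cast_ne_zero.mpr ha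
    have habs : (a.natAbs : ℝ) ≠ 0 := by exact_mod_cast Int.natAbs_ne_zero.mpr ha
    have sign_mul : (a.sign : ℝ) * a = a.natAbs := by
      rw [Nat.cast_natAbs, ← Int.sign_mul_self_eq_abs]
      push_cast
      rfl
    rw [inv_div, div_eq_div_iff ha' habs, ← sign_mul]
    push_cast
    ring
  · simpa [Int.natAbs_mul, Int.natAbs_sign_of_ne_zero ha] using size_b

lemma div (hx : IsFrac A x) (hy : IsFrac B y) : IsFrac (A + B) (x / y) :=
  div_eq_mul_inv x y ▸ hx.mul hy.inv

lemma add (hx : IsFrac A x) (hy : IsFrac B y) : IsFrac (A + B + 1) (x + y) := by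
  obtain ⟨a, b, hb, rfl, size_a, size_b⟩ := hx
  obtain ⟨c, d, hd, rfl, size_c, size_d⟩ := hy
  have hb' : (b : ℝ) ≠ 0 := Nat.cast_ne_zero.mpr hb
  have hd' : (d : ℝ) ≠ 0 := Nat.cast_ne_zero.mpr hd
  refine ⟨a * d + b * c, b * d, mul_ne_zero hb hd, by push_cast; field_simp, ?_, ?_⟩
  · refine (Nat.size_le_size (Int.natAbs_add_le _ _)).trans ?_
    rw [Int.natAbs_mul, Int.natAbs_mul]
    exact size_add_le ((size_mul_le _ _).trans (add_le_add size_a size_d))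
      ((size_mul_le _ _).trans (add_le_add size_b size_c))
  · exact ((size_mul_le _ _).trans (add_le_add size_b size_d)).trans (Nat.le_succ _)

lemma sum {ι : Type*} {s : Finset ι} {A : ι → ℕ} {x : ι → ℝ} (hx : ∀ i ∈ s, IsFrac (A i) (x i)) :
    IsFrac (∑ i ∈ s, (A i + 1) + 1) (∑ i ∈ s, x i) := by
  classical
  induction s using Finset.induction_on with
  | empty => simpa using natCast (A := 1) (k := 0) (by simp) le_rfl
  | insert a s ha ih =>
    rw [Finset.sum_insert ha, Finset.sum_insert ha]
    exact ((hx a (s.mem_insert_self a)).add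
      (ih fun i hi => hx i (Finset.mem_insert_of_mem hi))).mono (by omega)

lemma neg (hx : IsFrac A x) : IsFrac A (-x) := by
  obtain ⟨a, b, hb, rfl, size_a, size_b⟩ := hx
  exact ⟨-a, b, hb, by push_cast; ring, by simpa using size_a, size_b⟩

lemma sub (hx : IsFrac A x) (hy : IsFrac B y) : IsFrac (A + B + 1) (x - y) :=
  sub_eq_add_neg x y ▸ hx.add hy.neg

lemma floor (hx : IsFrac A x) : IsFrac A (⌊x⌋ : ℝ) := by
  have one_le := hx.one_le
  obtain ⟨a, b, -, rfl, size_a, -⟩ := hx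
  refine ⟨a / b, 1, one_ne_zero, ?_, ?_, by simpa using one_le⟩
  · rw [Int.floor_div_natCast, Int.floor_intCast, Nat.cast_one, div_one]
  · exact (Nat.size_le_size (Int.natAbs_ediv_le_natAbs a b)).trans size_a

end IsFrac

/-- If all values satisfying `P` are quotients of integers with at most `B` binary digits each, then
`x` is such a quotient with `k * B` instead of `B`. The bit lengths of all values computed by a
program are controlled in this way, by those of the values which it keeps in the memory. -/
def HasGrowth (P : ℝ → Prop) (k : ℕ) (x : ℝ) : Prop :=
  ∀ B, 1 ≤ B → (∀ y, P y → IsFrac B y) → IsFrac (k * B) x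

lemma HasGrowth.mono {P : ℝ → Prop} {k k' : ℕ} {x : ℝ} (hx : HasGrowth P k x) (h : k ≤ k') :
    HasGrowth P k' x := fun B hB hP => (hx B hB hP).mono (Nat.mul_le_mul_right B h)

lemma HasGrowth.of_mem {P : ℝ → Prop} {x : ℝ} (hx : P x) : HasGrowth P 1 x :=
  fun B _ hP => (one_mul B).symm ▸ hP x hx

namespace Expr

/-- A factor by which the bit length of the numbers in the memory grows at most when the expression
is evaluated. -/
def growth : Expr → ℕ
  | const q => q.num.natAbs + q.den
  | get _ e => e.growth + 1
  | add e₁ e₂ => e₁.growth + e₂.growth + 1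
  | sub e₁ e₂ => e₁.growth + e₂.growth + 1
  | mul e₁ e₂ => e₁.growth + e₂.growth + 1
  | div e₁ e₂ => e₁.growth + e₂.growth + 1
  | floor e => e.growth

variable {P : ℝ → Prop} {k : ℕ} {m : Mem}

lemma isFrac_eval {B : ℕ} (hm : ∀ a j, IsFrac B (m a j)) (e : Expr) :
    IsFrac (e.growth * B) (e.eval m) := by
  have hB := (hm 0 0).one_le
  induction e with
  | const q =>
    have le_mul : q.num.natAbs + q.den ≤ (q.num.natAbs + q.den) * B := Nat.le_mul_of_pos_right _ hB
    exact .ratCast ((size_le_self _).trans ((Nat.le_add_right _ _).trans le_mul))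
      ((size_le_self _).trans ((Nat.le_add_left _ _).trans le_mul))
  | get a e _ => exact (hm _ _).mono (Nat.le_mul_of_pos_left _ (Nat.succ_pos _))
  | add _ _ ih₁ ih₂ => exact (ih₁.add ih₂).mono (by simp only [growth]; linarith)
  | sub _ _ ih₁ ih₂ => exact (ih₁.sub ih₂).mono (by simp only [growth]; linarith)
  | mul _ _ ih₁ ih₂ => exact (ih₁.mul ih₂).mono (by simp only [growth]; linarith)
  | div _ _ ih₁ ih₂ => exact (ih₁.div ih₂).mono (by simp only [growth]; linarith)
  | floor _ ih => exact ih.floor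

lemma hasGrowth_eval (hm : ∀ a j, HasGrowth P k (m a j)) (e : Expr) :
    HasGrowth P (e.growth * k) (e.eval m) := fun B hB hP =>
  (mul_assoc e.growth k B).symm ▸ e.isFrac_eval fun a j => hm a j B hB hP

lemma allOk_hasGrowth (hm : ∀ a j, HasGrowth P k (m a j)) {e : Expr} {K : ℕ}
    (he : e.growth ≤ K) : e.AllOk (HasGrowth P (K * k)) m := by
  have value_ok : ∀ e : Expr, e.growth ≤ K → HasGrowth P (K * k) (e.eval m) := fun e he =>
    (e.hasGrowth_eval hm).mono (Nat.mul_le_mul_right k he)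
  induction e with
  | const q => exact value_ok _ he
  | get _ _ ih => exact ⟨ih ((Nat.le_succ _).trans he), value_ok _ he⟩
  | floor _ ih => exact ⟨ih he, value_ok _ he⟩
  | add _ _ ih₁ ih₂ | sub _ _ ih₁ ih₂ | mul _ _ ih₁ ih₂ | div _ _ ih₁ ih₂ =>
    exact ⟨ih₁ (by simp only [growth] at he; omega), ih₂ (by simp only [growth] at he; omega),
      value_ok _ he⟩

end Expr

/-! ### Programs without loops -/

namespace Prog

/-- The program contains no loop. -/
def isLoopFree : Prog → Bool
  | skip => true
  | assign _ _ _ => true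
  | seq p₁ p₂ => p₁.isLoopFree && p₂.isLoopFree
  | ifLt _ _ p₁ p₂ => p₁.isLoopFree && p₂.isLoopFree
  | whileLt _ _ _ => false

/-- The memory after the execution of a loop-free program on `m`; loops are ignored. -/
noncomputable def run : Prog → Mem → Mem
  | skip, m => m
  | assign a j e, m => m.write a ⌊j.eval m⌋₊ (e.eval m)
  | seq p₁ p₂, m => p₂.run (p₁.run m)
  | ifLt e₁ e₂ p₁ p₂, m => open Classical in if e₁.eval m < e₂.eval m then p₁.run m else p₂.run m
  | whileLt _ _ _, m => m

/-- A bound for the running time of a loop-free program. -/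
def maxCost : Prog → ℕ
  | skip => 1
  | assign _ j e => j.cost + e.cost + 1
  | seq p₁ p₂ => p₁.maxCost + p₂.maxCost
  | ifLt e₁ e₂ p₁ p₂ => e₁.cost + e₂.cost + 1 + max p₁.maxCost p₂.maxCost
  | whileLt _ _ _ => 0

/-- A factor by which the bit length of the numbers in the memory grows at most during the execution
of a loop-free program. -/
def growth : Prog → ℕ
  | skip => 1
  | assign _ j e => j.growth + e.growth + 1
  | seq p₁ p₂ => p₁.growth * p₂.growth
  | ifLt e₁ e₂ p₁ p₂ => e₁.growth + e₂.growth + p₁.growth + p₂.growth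
  | whileLt _ _ _ => 1

lemma one_le_growth (p : Prog) : 1 ≤ p.growth := by
  induction p with
  | skip | whileLt _ _ _ => exact le_rfl
  | assign _ _ _ => exact Nat.le_add_left _ _
  | seq _ _ ih₁ ih₂ => exact Nat.mul_pos ih₁ ih₂
  | ifLt _ _ _ _ _ ih₂ => exact ih₂.trans (Nat.le_add_left _ _)

variable {P : ℝ → Prop} {k : ℕ} {m : Mem}

lemma hasGrowth_run (p : Prog) (hm : ∀ a j, HasGrowth P k (m a j)) :
    ∀ a j, HasGrowth P (p.growth * k) (p.run m a j) := by
  have of_le : ∀ {K : ℕ}, 1 ≤ K → ∀ a j, HasGrowth P (K * k) (m a j) := fun hK a j =>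
    (hm a j).mono (Nat.le_mul_of_pos_left k hK)
  induction p generalizing m k with
  | skip => exact of_le le_rfl
  | assign a j e =>
    exact Mem.forall_write (of_le (one_le_growth _))
      ((e.hasGrowth_eval hm).mono (Nat.mul_le_mul_right k (by simp only [growth]; omega))) _ _
  | seq p₁ p₂ ih₁ ih₂ =>
    intro a j
    have hm₁ := ih₁ hm of_le
    refine (ih₂ hm₁ (fun hK a j => (hm₁ a j).mono (Nat.le_mul_of_pos_left _ hK)) a j).mono ?_
    exact (by rw [growth, mul_left_comm, mul_assoc] : _ = _).le
  | ifLt e₁ e₂ p₁ p₂ ih₁ ih₂ =>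
    intro a j
    rw [run]
    split_ifs
    · exact (ih₁ hm of_le a j).mono (Nat.mul_le_mul_right k (by simp only [growth]; omega))
    · exact (ih₂ hm of_le a j).mono (Nat.mul_le_mul_right k (by simp only [growth]; omega))
  | whileLt _ _ _ => exact of_le le_rfl

lemma exists_exec_run {p : Prog} (hp : p.isLoopFree) (hm : ∀ a j, HasGrowth P k (m a j)) :
    ∃ c ≤ p.maxCost, Exec (HasGrowth P (p.growth * k)) p m (p.run m) c := by
  induction p generalizing m k with
  | skip => exact ⟨1, le_rfl, .skip m⟩
  | assign a j e =>
    exact ⟨_, le_rfl, .assign m a j e (Expr.allOk_hasGrowth hm (by simp only [growth]; omega))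
      (Expr.allOk_hasGrowth hm (by simp only [growth]; omega))⟩
  | seq p₁ p₂ ih₁ ih₂ =>
    rw [isLoopFree, Bool.and_eq_true] at hp
    obtain ⟨c₁, hc₁, exec₁⟩ := ih₁ hp.1 hm
    obtain ⟨c₂, hc₂, exec₂⟩ := ih₂ hp.2 (p₁.hasGrowth_run hm)
    refine ⟨c₁ + c₂, add_le_add hc₁ hc₂, .seq (exec₁.mono fun x hx => hx.mono ?_)
      (exec₂.mono fun x hx => hx.mono ?_)⟩
    · exact Nat.mul_le_mul_right k (Nat.le_mul_of_pos_right _ p₂.one_le_growth)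
    · exact (by rw [growth, mul_left_comm, mul_assoc] : _ = _).le
  | ifLt e₁ e₂ p₁ p₂ ih₁ ih₂ =>
    rw [isLoopFree, Bool.and_eq_true] at hp
    have ok₁ : e₁.AllOk (HasGrowth P ((ifLt e₁ e₂ p₁ p₂).growth * k)) m :=
      Expr.allOk_hasGrowth hm (by simp only [growth]; omega)
    have ok₂ : e₂.AllOk (HasGrowth P ((ifLt e₁ e₂ p₁ p₂).growth * k)) m :=
      Expr.allOk_hasGrowth hm (by simp only [growth]; omega)
    have weaken {q : Prog} (hq : q.growth ≤ (ifLt e₁ e₂ p₁ p₂).growth) {m' : Mem} {c : ℕ}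
        (exec : Exec (HasGrowth P (q.growth * k)) q m m' c) :
        Exec (HasGrowth P ((ifLt e₁ e₂ p₁ p₂).growth * k)) q m m' c :=
      exec.mono fun x hx => hx.mono (Nat.mul_le_mul_right k hq)
    rw [run, maxCost]
    split_ifs with hlt
    · obtain ⟨c, hc, exec⟩ := ih₁ hp.1 hm
      exact ⟨_, by omega, .ifTrue ok₁ ok₂ hlt (weaken (by simp only [growth]; omega) exec)⟩
    · obtain ⟨c, hc, exec⟩ := ih₂ hp.2 hm
      exact ⟨_, by omega, .ifFalse ok₁ ok₂ hlt (weaken (by simp only [growth]; omega) exec)⟩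
  | whileLt _ _ _ => exact absurd hp Bool.false_ne_true

end Prog

lemma Reaches.of_run {P : ℝ → Prop} {K k : ℕ} {p : Prog} {m : Mem} {Q : Mem → Prop}
    (hm : ∀ a j, P (m a j)) (hQ : Q (p.run m)) (hp : p.isLoopFree := by decide)
    (hK : p.growth ≤ K := by decide) (hk : p.maxCost ≤ k := by decide) :
    Reaches (HasGrowth P K) p m k Q := by
  obtain ⟨c, hc, exec⟩ := Prog.exists_exec_run hp fun a j => HasGrowth.of_mem (hm a j)
  exact ⟨_, c, exec.mono fun x hx => hx.mono (by simpa using hK), hc.trans hk, hQ⟩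

lemma Expr.allOk_of_forall {P : ℝ → Prop} {K : ℕ} {e : Expr} {m : Mem} (hm : ∀ a j, P (m a j))
    (hK : e.growth ≤ K := by decide) : e.AllOk (HasGrowth P K) m :=
  mul_one K ▸ Expr.allOk_hasGrowth (fun a j => .of_mem (hm a j)) hK

/-! ### Binary trees of bamboos -/

/-- Binary trees whose leaves are bamboos. -/
inductive Tree : Type
  | leaf (i : ℕ)
  | node (l r : Tree)

namespace Tree

/-- The leaf reached from the root when the binary digits of `c`, lowest first, are followed. -/
def walk : Tree → ℕ → ℕ
  | leaf i, _ => i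
  | node l r, c => if c % 2 = 0 then l.walk (c / 2) else r.walk (c / 2)

/-- `i` is a leaf of the tree. -/
def HasLeaf (i : ℕ) : Tree → Prop
  | leaf i' => i' = i
  | node l r => l.HasLeaf i ∨ r.HasLeaf i

/-- The height of a tree. -/
def height : Tree → ℕ
  | leaf _ => 0
  | node l r => max l.height r.height + 1

/-- The least weight of the root for which the leaves get at least their weights `g` when weights
are halved from a node to its children. -/
noncomputable def weight (g : ℕ → ℝ) : Tree → ℝ
  | leaf i => g i
  | node l r => 2 * max (l.weight g) (r.weight g)

variable {g : ℕ → ℝ} {T : Tree} {i : ℕ}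

lemma hasLeaf_walk (T : Tree) (c : ℕ) : T.HasLeaf (T.walk c) := by
  induction T generalizing c with
  | leaf i => rfl
  | node l r ihl ihr =>
    rw [walk]
    split_ifs
    · exact Or.inl (ihl _)
    · exact Or.inr (ihr _)

lemma exists_walk_eq (hi : T.HasLeaf i) :
    ∃ d ρ, ρ < 2 ^ d ∧ 2 ^ d * g i ≤ T.weight g ∧ ∀ c, c % 2 ^ d = ρ → T.walk c = i := by
  have lowest_digit : ∀ c d, c % 2 ^ (d + 1) = c % 2 + 2 * (c / 2 % 2 ^ d) := fun c d => by
    rw [pow_succ', Nat.mod_mul]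
  induction T with
  | leaf i' =>
    obtain rfl : i' = i := hi
    exact ⟨0, 0, by simp, by simp [weight], fun c _ => rfl⟩
  | node l r ihl ihr =>
    rcases hi with hi | hi
    · obtain ⟨d, ρ, hρ, le_weight, walk_eq⟩ := ihl hi
      refine ⟨d + 1, 2 * ρ, by rw [pow_succ]; omega, ?_, fun c hc => ?_⟩
      · rw [pow_succ', mul_assoc, weight]
        gcongr
        exact le_max_of_le_left le_weight
      · rw [lowest_digit] at hc
        rw [walk, if_pos (by omega)]
        exact walk_eq _ (by omega)
    · obtain ⟨d, ρ, hρ, le_weight, walk_eq⟩ := ihr hi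
      refine ⟨d + 1, 2 * ρ + 1, by rw [pow_succ]; omega, ?_, fun c hc => ?_⟩
      · rw [pow_succ', mul_assoc, weight]
        gcongr
        exact le_max_of_le_right le_weight
      · rw [lowest_digit] at hc
        rw [walk, if_neg (by omega)]
        exact walk_eq _ (by omega)

lemma le_weight (hg : 0 ≤ g i) (hi : T.HasLeaf i) : g i ≤ T.weight g := by
  obtain ⟨d, -, -, le_weight, -⟩ := exists_walk_eq (g := g) hi
  exact (le_mul_of_one_le_left hg (one_le_pow₀ one_le_two)).trans le_weight

lemma exists_weight_eq (g : ℕ → ℝ) (T : Tree) :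
    ∃ i, T.HasLeaf i ∧ ∃ e : ℕ, T.weight g = 2 ^ e * g i := by
  induction T with
  | leaf i => exact ⟨i, rfl, 0, by simp [weight]⟩
  | node l r ihl ihr =>
    rw [weight]
    rcases max_choice (l.weight g) (r.weight g) with h | h <;> rw [h]
    · obtain ⟨i, hi, e, he⟩ := ihl
      exact ⟨i, Or.inl hi, e + 1, by rw [he, pow_succ', mul_assoc]⟩
    · obtain ⟨i, hi, e, he⟩ := ihr
      exact ⟨i, Or.inr hi, e + 1, by rw [he, pow_succ', mul_assoc]⟩

lemma weight_pos (hg : ∀ i, T.HasLeaf i → 0 < g i) : 0 < T.weight g := by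
  obtain ⟨i, hi, e, he⟩ := T.exists_weight_eq g
  rw [he]
  exact mul_pos (by positivity) (hg i hi)

lemma two_pow_height_mul_le {b : ℝ} (hb : ∀ i, T.HasLeaf i → b ≤ g i) :
    2 ^ T.height * b ≤ T.weight g := by
  induction T with
  | leaf i => simpa [height, weight] using hb i rfl
  | node l r ihl ihr =>
    have hl := ihl fun i hi => hb i (Or.inl hi)
    have hr := ihr fun i hi => hb i (Or.inr hi)
    rw [height, weight, pow_succ', mul_assoc]
    gcongr
    rcases max_choice l.height r.height with h | h <;> rw [h]
    · exact le_max_of_le_left hl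
    · exact le_max_of_le_right hr

end Tree

/-! ### Merging the smallest weights -/

/-- The bamboos `0, …, n - 1` are leaves of the trees `T 0, …, T (N - 1)`, which have weight at most
`b`; the sum of the weights exceeds `E` at most by the least weight. -/
structure IsForest (n : ℕ) (g : ℕ → ℝ) (b E : ℝ) (N : ℕ) (T : ℕ → Tree) : Prop where
  two_le : 2 ≤ N
  leaf_lt : ∀ j i, (T j).HasLeaf i → i < n
  exists_hasLeaf : ∀ i < n, ∃ j < N, (T j).HasLeaf i
  weight_le : ∀ j, (T j).weight g ≤ b
  sum_le : ∃ c, ∑ j ∈ Finset.range N, (T j).weight g ≤ E + c ∧ ∀ j < N, c ≤ (T j).weight g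

namespace IsForest

variable {n N : ℕ} {g : ℕ → ℝ} {b E : ℝ} {T : ℕ → Tree}

lemma weight_pos (h : IsForest n g b E N T) (hg : ∀ i < n, 0 < g i) (j : ℕ) :
    0 < (T j).weight g :=
  Tree.weight_pos fun i hi => hg i (h.leaf_lt j i hi)

lemma leaves (hn : 2 ≤ n) (hb : ∀ i < n, g i ≤ b) (hE : ∑ i ∈ Finset.range n, g i ≤ E)
    (hg : ∀ i < n, 0 ≤ g i) :
    IsForest n g b E n fun j => .leaf (if j < n then j else 0) where
  two_le := hn
  leaf_lt j i hi := by
    obtain rfl : (if j < n then j else 0) = i := hi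
    split_ifs <;> omega
  exists_hasLeaf i hi := ⟨i, hi, if_pos hi⟩
  weight_le j := by
    rw [Tree.weight]
    split_ifs with hj
    exacts [hb j hj, hb 0 (by omega)]
  sum_le := by
    refine ⟨0, ?_, fun j hj => ?_⟩
    · rw [add_zero]
      refine (Finset.sum_congr rfl fun j hj => ?_).trans_le hE
      rw [Tree.weight, if_pos (Finset.mem_range.mp hj)]
    · rw [Tree.weight, if_pos hj]
      exact hg j hj

lemma comp_perm (h : IsForest n g b E N T) (σ : Equiv.Perm ℕ) (hσ : ∀ j, σ j < N ↔ j < N) :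
    IsForest n g b E N (T ∘ σ) where
  two_le := h.two_le
  leaf_lt j := h.leaf_lt (σ j)
  exists_hasLeaf i hi := by
    obtain ⟨j, hj, leaf⟩ := h.exists_hasLeaf i hi
    exact ⟨σ.symm j, (hσ _).mp (by rwa [σ.apply_symm_apply]), by simpa using leaf⟩
  weight_le j := h.weight_le (σ j)
  sum_le := by
    obtain ⟨c, sum_le, le_weight⟩ := h.sum_le
    refine ⟨c, (Finset.sum_equiv σ (fun j => ?_) fun j _ => rfl).trans_le sum_le,
      fun j hj => le_weight _ ((hσ j).mpr hj)⟩
    rw [Finset.mem_range, Finset.mem_range, hσ]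

lemma sum_range_le (h : IsForest n g b E (N + 1) T) :
    ∑ j ∈ Finset.range N, (T j).weight g ≤ E := by
  obtain ⟨c, sum_le, le_weight⟩ := h.sum_le
  rw [Finset.sum_range_succ] at sum_le
  linarith [le_weight N N.lt_succ_self]

lemma le_weight_zero (h : IsForest n g b E N T)
    (hT : AntitoneOn (fun j => (T j).weight g) (Set.Iio N)) {i : ℕ} (hi : i < n) (hg : 0 ≤ g i) :
    g i ≤ (T 0).weight g := by
  obtain ⟨j, hj, leaf⟩ := h.exists_hasLeaf i hi
  exact (Tree.le_weight hg leaf).trans (hT (j.zero_le.trans_lt hj) hj j.zero_le)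

lemma merge (h : IsForest n g b E (N + 2) T)
    (hT : AntitoneOn (fun j => (T j).weight g) (Set.Iio (N + 2))) (hN : 1 ≤ N)
    (hpos : 0 ≤ (T N).weight g) (hb : 2 * (T N).weight g ≤ b) :
    IsForest n g b E (N + 1) (Function.update T N (.node (T N) (T (N + 1)))) := by
  have weight_le : (T (N + 1)).weight g ≤ (T N).weight g := hT (by simp) (by simp) N.le_succ
  have node_weight : (Tree.node (T N) (T (N + 1))).weight g = 2 * (T N).weight g := by
    rw [Tree.weight, max_eq_left weight_le]
  refine ⟨by omega, fun j i hi => ?_, fun i hi => ?_, fun j => ?_, (T N).weight g, ?_,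
    fun j hj => ?_⟩
  · rcases eq_or_ne j N with rfl | hj
    · rw [Function.update_self] at hi
      exact hi.elim (h.leaf_lt _ _) (h.leaf_lt _ _)
    · rw [Function.update_of_ne hj] at hi
      exact h.leaf_lt j i hi
  · obtain ⟨j, hj, leaf⟩ := h.exists_hasLeaf i hi
    rcases lt_or_ge j N with hjN | hjN
    · exact ⟨j, by omega, by rwa [Function.update_of_ne hjN.ne]⟩
    · refine ⟨N, N.lt_succ_self, ?_⟩
      rw [Function.update_self]
      obtain rfl | rfl : j = N ∨ j = N + 1 := by omega
      exacts [Or.inl leaf, Or.inr leaf]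
  · rcases eq_or_ne j N with rfl | hj
    · rwa [Function.update_self, node_weight]
    · rw [Function.update_of_ne hj]
      exact h.weight_le j
  · have sum_eq : ∑ j ∈ Finset.range N,
        (Function.update T N (.node (T N) (T (N + 1))) j).weight g =
        ∑ j ∈ Finset.range N, (T j).weight g := Finset.sum_congr rfl fun j hj => by
      rw [Function.update_of_ne (Finset.mem_range.mp hj).ne]
    have sum_le := h.sum_range_le
    rw [Finset.sum_range_succ] at sum_le ⊢
    rw [sum_eq, Function.update_self, node_weight]
    linarith
  · rcases (Nat.le_of_lt_succ hj).eq_or_lt with rfl | hjN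
    · rw [Function.update_self, node_weight]
      linarith
    · rw [Function.update_of_ne hjN.ne]
      exact hT (Set.mem_Iio.mpr (by omega)) (by simp) hjN.le

end IsForest

/-! ### Insertion into a descending sequence -/

/-- The first `N` terms of `w` are in descending order, except that the term with index `j` may have
to be moved forward. -/
def AntitoneExcept (w : ℕ → ℝ) (N j : ℕ) : Prop := ∀ a b, a < b → b < N → b ≠ j → w b ≤ w a

namespace AntitoneExcept

variable {w : ℕ → ℝ} {N j : ℕ}

lemma antitoneOn (h : AntitoneExcept w N 0) : AntitoneOn w (Set.Iio N) := by
  intro a _ b hb hab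
  rcases hab.eq_or_lt with rfl | hab
  · exact le_rfl
  · exact h a b hab hb (by omega)

lemma of_antitoneOn (h : AntitoneOn w (Set.Iio (N + 2))) (x : ℝ) :
    AntitoneExcept (Function.update w N x) (N + 1) N := by
  intro a b hab hb hbN
  rw [Function.update_of_ne (by omega), Function.update_of_ne (by omega)]
  exact h (Set.mem_Iio.mpr (by omega)) (Set.mem_Iio.mpr (by omega)) hab.le

lemma comp_swap (h : AntitoneExcept w N (j + 1)) (hlt : w j < w (j + 1)) :
    AntitoneExcept (w ∘ Equiv.swap j (j + 1)) N j := by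
  intro a b hab hb hbj
  simp only [Function.comp_apply, Equiv.swap_apply_def]
  split_ifs <;> first | omega | exact hlt.le | exact h _ _ (by omega) (by omega) (by omega)

lemma of_succ (h : AntitoneExcept w N (j + 1)) (hle : w (j + 1) ≤ w j) :
    AntitoneExcept w N j := by
  intro a b hab hb _
  rcases eq_or_ne b (j + 1) with rfl | hbj
  · rcases (Nat.le_of_lt_succ hab).eq_or_lt with rfl | ha
    · exact hle
    · exact hle.trans (h a j ha (by omega) (by omega))
  · exact h a b hab hb hbj

end AntitoneExcept

/-! ### Bins -/

/-- The number of weights in a bin whose first weight is `x s`, if there are `p` bins, each with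
room for weights of sum `1 / p`: all weights in the bin are counted as `x s`. -/
noncomputable def binCount (p : ℕ) (x : ℕ → ℝ) (s : ℕ) : ℕ := ⌊1 / (p * x s)⌋₊

/-- The position of the first weight of bin `j` if the weights `x` are packed greedily. -/
noncomputable def binStart (p : ℕ) (x : ℕ → ℝ) : ℕ → ℕ
  | 0 => 0
  | j + 1 => binStart p x j + binCount p x (binStart p x j)

/-- The bound on the periods of the roots, as a function of `⌊1 / u⌋`, where `u` is the largest
weight before rounding. -/
def minPeriod (r : ℕ) : ℕ := if r < 4 then r else if r < 12 then 2 * (r / 2) else 4 * (r / 4)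

/-- The number of bins, unless there is one for each root, as a function of `⌊1 / u⌋`. -/
def numBins (r : ℕ) : ℕ := if r < 4 then r else if r < 12 then 2 else r / 4

lemma minPeriod_le (r : ℕ) : minPeriod r ≤ r := by
  unfold minPeriod
  split_ifs <;> omega

lemma lt_two_mul_minPeriod {r : ℕ} (hr : 2 ≤ r) : r < 2 * minPeriod r := by
  unfold minPeriod
  split_ifs <;> omega

lemma numBins_le_minPeriod (r : ℕ) : numBins r ≤ minPeriod r := by
  unfold numBins minPeriod
  split_ifs <;> omega

lemma numBins_pos {r : ℕ} (hr : 2 ≤ r) : 0 < numBins r := by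
  unfold numBins
  split_ifs <;> omega

lemma minPeriod_pos {r : ℕ} (hr : 2 ≤ r) : 0 < minPeriod r :=
  (numBins_pos hr).trans_le (numBins_le_minPeriod r)

section Bins

variable {x : ℕ → ℝ} {p s M : ℕ} {u : ℝ}

lemma lt_binCount_add_one_mul (hp : 0 < p) (hx : 0 < x s) :
    1 < (binCount p x s + 1) * (p * x s) :=
  (div_lt_iff₀ (by positivity)).mp (Nat.lt_floor_add_one _)

lemma binCount_mul_le (hp : 0 < p) (hx : 0 < x s) : binCount p x s * (p * x s) ≤ 1 :=
  (le_div_iff₀ (by positivity)).mp (Nat.floor_le (by positivity))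

lemma le_binCount {c : ℕ} (hp : 0 < p) (hx : 0 < x s) (h : c * (p * x s) ≤ 1) :
    c ≤ binCount p x s :=
  Nat.le_floor ((le_div_iff₀ (by positivity)).mpr h)

lemma binCount_lt {c : ℕ} (hp : 0 < p) (hx : 0 < x s) (h : 1 < c * (p * x s)) :
    binCount p x s < c :=
  (Nat.floor_lt (by positivity)).mpr ((div_lt_iff₀ (by positivity)).mpr h)

lemma binStart_monotone : Monotone (binStart p x) :=
  monotone_nat_of_le_succ fun _ => Nat.le_add_right _ _

lemma le_sum_range_add {k : ℕ} {b : ℝ} (hk : 1 ≤ k) (hb : ∀ i, s < i → i < s + k → b ≤ x i) :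
    ∑ i ∈ Finset.range s, x i + x s + (k - 1) * b ≤ ∑ i ∈ Finset.range (s + k), x i := by
  induction k, hk using Nat.le_induction with
  | base => simp [Finset.sum_range_succ]
  | succ k hk ih =>
    have ih := ih fun i hsi hi => hb i hsi (by omega)
    have le_last := hb (s + k) (by omega) (by omega)
    rw [← add_assoc, Finset.sum_range_succ]
    push_cast
    linarith

lemma sum_range_le_sum_range_of_pos (hx : ∀ i, 0 < x i) (h : s ≤ M) :
    ∑ i ∈ Finset.range s, x i ≤ ∑ i ∈ Finset.range M, x i :=
  Finset.sum_le_sum_of_subset_of_nonneg (Finset.range_mono h) fun i _ _ => (hx i).le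

lemma min_le_binStart (hx : ∀ i, 0 < x i) (hle : ∀ s < p, p * x s ≤ 1) (j : ℕ) :
    min j p ≤ binStart p x j := by
  induction j with
  | zero => simp
  | succ j ih =>
    rw [binStart]
    rcases lt_or_ge (binStart p x j) p with hj | hj
    · have : 1 ≤ binCount p x (binStart p x j) :=
        le_binCount (by omega) (hx _) (by simpa using hle _ hj)
      omega
    · omega

lemma lt_of_sum_range_le {r : ℕ} (hr₂ : 2 ≤ r) (hr₄ : r < 4) (hx : ∀ i, 0 < x i)
    (hlow : ∀ i < M, 1 ≤ x i * (2 * r)) (hu : 1 < u * (r + 1)) (hux : u ≤ x 0)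
    (hsum : ∑ i ∈ Finset.range M, x i ≤ 3 / 4 * (1 - u) + 1 / 1000) : M < r := by
  by_contra! hM
  have le_sum := (le_sum_range_add (x := x) (s := 0) (k := r) (b := 1 / (2 * r)) (by omega)
    fun i _ hi => (div_le_iff₀ (by positivity)).mpr (hlow i (by omega))).trans
      (sum_range_le_sum_range_of_pos hx ((zero_add r).trans_le hM))
  simp only [Finset.range_zero, Finset.sum_empty, zero_add] at le_sum
  interval_cases r <;> norm_num at le_sum hu <;> linarith

lemma lt_binStart_two {K : ℕ} (hK₂ : 2 ≤ K) (hK₅ : K ≤ 5) (hsmall : 1 < 5 * x 0 ∨ 5 ≤ M)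
    (hx : ∀ i, 0 < x i) (hanti : AntitoneOn x (Set.Iio (M + 1))) (hup : ∀ i, x i * (2 * K) ≤ 1)
    (hlow : ∀ i < M, 1 ≤ x i * (4 * K)) (hu : 1 < u * (2 * K + 2)) (hux : u ≤ x 0)
    (hsum : ∑ i ∈ Finset.range M, x i ≤ 3 / 4 * (1 - u) + 1 / 1000) : M < binStart 2 x 2 := by
  have le_count : ∀ s, K ≤ binCount 2 x s := fun s =>
    le_binCount two_pos (hx s) (by push_cast; linarith [hup s])
  have count_zero : binCount 2 x 0 = K :=
    (Nat.lt_succ_iff.mp <| binCount_lt two_pos (hx 0) <| by push_cast; nlinarith).antisymm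
      (le_count 0)
  have start_two : binStart 2 x 2 = K + binCount 2 x K := by simp [binStart, count_zero]
  by_contra! hM
  rw [start_two] at hM
  have hKc := le_count K
  have lt_count := lt_binCount_add_one_mul (p := 2) two_pos (hx K)
  have count_le : binCount 2 x K ≤ 2 * K :=
    Nat.lt_succ_iff.mp <| binCount_lt two_pos (hx K) <| by
      push_cast
      linarith [hlow K (by omega), hx K]
  generalize binCount 2 x K = c at hM hKc lt_count count_le
  have le_first_bin := le_sum_range_add (x := x) (s := 0) (k := K) (b := x K) (by omega)
    fun i _ hi => hanti (Set.mem_Iio.mpr (by omega)) (Set.mem_Iio.mpr (by omega)) (by omega)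
  have le_both_bins := le_sum_range_add (x := x) (s := K) (k := c) (b := 1 / (4 * K)) (by omega)
    fun i _ hi => (div_le_iff₀ (by positivity)).mpr (hlow i (by omega))
  have le_sum := sum_range_le_sum_range_of_pos hx hM
  -- For two weights in each bin, one more weight is needed to reach the bound for the sum.
  have extra_weight : K = 2 → c = 2 → 5 ≤ M →
      ∑ i ∈ Finset.range 4, x i + 1 / 8 ≤ ∑ i ∈ Finset.range M, x i := by
    rintro rfl - hM₅
    have le_sum := sum_range_le_sum_range_of_pos hx hM₅
    have := hlow 4 (by omega)
    rw [Finset.sum_range_succ] at le_sum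
    push_cast at this
    linarith
  simp only [Finset.range_zero, Finset.sum_empty, zero_add] at le_first_bin
  interval_cases K <;> interval_cases c <;> norm_num at * <;>
    first | linarith | rcases hsmall with hsmall | hsmall <;> grind

/-- If no weight in the first `j` bins is less than `v / p`, then these weights have a sum of at
least `(4 / 5 * j + potential v) / p`. A bin may contain less than `4 / 5 / p`, but only if the
weights decrease in it so much that the potential decreases too. -/
noncomputable def potential (v : ℝ) : ℝ :=
  if 1 / 5 < v then 0 else if 1 / 6 < v then -1 / 10 else if 1 / 7 < v then -6 / 35 else -7 / 30

lemma potential_nonpos (v : ℝ) : potential v ≤ 0 := by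
  unfold potential
  split_ifs <;> norm_num

lemma potential_add_le {v v' : ℝ} {k : ℕ} (hv : 1 / 8 ≤ v) (hvv' : v ≤ v') (hv' : v' ≤ 1 / 4)
    (hk : 1 < (k + 1) * v') : potential v + 4 / 5 ≤ potential v' + v' + (k - 1) * v := by
  have le_count : ∀ c : ℕ, v' * c ≤ 1 → (c - 1) * v ≤ (k - 1) * v := by
    intro c hc
    have hck : (c : ℝ) < k + 1 := by
      by_contra! hcon
      nlinarith
    have : (c : ℝ) ≤ k := by exact_mod_cast Nat.lt_succ_iff.mp (by exact_mod_cast hck)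
    gcongr
  by_cases h₅ : 1 / 5 < v'
  · have := le_count 4 (by push_cast; linarith)
    push_cast at this
    unfold potential
    split_ifs <;> linarith
  by_cases h₆ : 1 / 6 < v'
  · have := le_count 5 (by push_cast; linarith)
    push_cast at this
    unfold potential
    split_ifs <;> linarith
  by_cases h₇ : 1 / 7 < v'
  · have := le_count 6 (by push_cast; linarith)
    push_cast at this
    unfold potential
    split_ifs <;> linarith
  · have := le_count 7 (by push_cast; linarith)
    push_cast at this
    unfold potential
    split_ifs <;> linarith

lemma potential_le_mul_sum_range (hp : 0 < p) (hx : ∀ i, 0 < x i)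
    (hanti : AntitoneOn x (Set.Iio (M + 1))) (hup : ∀ i, x i * (4 * p) ≤ 1) {j : ℕ}
    (hj : binStart p x j ≤ M) {v : ℝ} (hv : 1 / 8 ≤ v)
    (hvx : ∀ i < binStart p x j, v ≤ p * x i) :
    4 / 5 * j + potential v ≤ p * ∑ i ∈ Finset.range (binStart p x j), x i := by
  induction j generalizing v with
  | zero => simpa [binStart] using potential_nonpos v
  | succ j ih =>
    have hpR : (0 : ℝ) < p := by exact_mod_cast hp
    have hsM : binStart p x j ≤ M := (binStart_monotone j.le_succ).trans hj
    have ih := @ih hsM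
    rw [binStart] at hj hvx ⊢
    generalize binStart p x j = s at *
    have count_pos : 1 ≤ binCount p x s := le_binCount hp (hx s) (by
      push_cast
      nlinarith [hup s, hx s])
    have hvs : v ≤ p * x s := hvx s (by omega)
    have le_prefix := ih (hv.trans hvs) fun i hi => mul_le_mul_of_nonneg_left
      (hanti (Set.mem_Iio.mpr (by omega)) (Set.mem_Iio.mpr (by omega)) hi.le) hpR.le
    have le_potential := potential_add_le hv hvs (by linarith [hup s])
      (lt_binCount_add_one_mul hp (hx s))
    have le_sum := mul_le_mul_of_nonneg_left (le_sum_range_add count_pos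
      fun i _ hi => (div_le_iff₀' hpR).mpr (hvx i hi)) hpR.le
    rw [mul_add, mul_add, mul_left_comm, mul_div_cancel₀ _ hpR.ne'] at le_sum
    push_cast
    linarith

lemma lt_binStart_of_three_le (hp : 3 ≤ p) (hx : ∀ i, 0 < x i)
    (hanti : AntitoneOn x (Set.Iio (M + 1))) (hup : ∀ i, x i * (4 * p) ≤ 1)
    (hlow : ∀ i < M, 1 ≤ x i * (8 * p)) (hu₀ : 0 < u) (hu : 1 < u * (4 * p + 4))
    (hsum : ∑ i ∈ Finset.range M, x i ≤ 3 / 4 * (1 - u) + 1 / 1000) : M < binStart p x p := by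
  by_contra! hM
  have hpR : (0 : ℝ) < p := by exact_mod_cast (by omega : 0 < p)
  have le_sum := potential_le_mul_sum_range (by omega) hx hanti hup hM le_rfl fun i hi => by
    linarith [hlow i (by omega)]
  have sum_le := mul_le_mul_of_nonneg_left ((sum_range_le_sum_range_of_pos hx hM).trans hsum) hpR.le
  have potential_eq : potential (1 / 8) = -7 / 30 := by norm_num [potential]
  rw [potential_eq] at le_sum
  obtain rfl | rfl | hp₅ : p = 3 ∨ p = 4 ∨ 5 ≤ p := by omega
  · norm_num at *
    linarith
  · norm_num at *
    linarith
  · have : (5 : ℝ) ≤ p := by exact_mod_cast hp₅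
    nlinarith [mul_pos hpR hu₀]

lemma lt_binStart_numBins {r : ℕ} (hr : 2 ≤ r) (hx : ∀ i, 0 < x i)
    (hanti : AntitoneOn x (Set.Iio (M + 1))) (hup : ∀ i, x i * minPeriod r ≤ 1)
    (hlow : ∀ i < M, 1 ≤ x i * (2 * minPeriod r)) (hu₀ : 0 < u) (hu : 1 < u * (r + 1))
    (hux : u ≤ x 0) (hsum : ∑ i ∈ Finset.range M, x i ≤ 3 / 4 * (1 - u) + 1 / 1000)
    (hM : 1 < (M + 1) * x 0) : M < binStart (numBins r) x (numBins r) := by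
  unfold minPeriod at hup hlow
  unfold numBins
  split_ifs at hup hlow ⊢ with h₄ h₁₂
  · have hMr := lt_of_sum_range_le hr h₄ hx hlow hu hux hsum
    have : (M + 1 : ℝ) ≤ r := by exact_mod_cast hMr
    nlinarith [hup 0, hx 0]
  · push_cast at hup hlow
    refine lt_binStart_two (K := r / 2) (by omega) (by omega) ?_ hx hanti hup
      (fun i hi => (hlow i hi).trans_eq (by ring)) ?_ hux hsum
    · by_contra! hcon
      have : (M + 1 : ℝ) ≤ 5 := by exact_mod_cast hcon.2
      nlinarith [hx 0]
    · have : (r : ℝ) ≤ 2 * (r / 2 : ℕ) + 1 := by exact_mod_cast (by omega)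
      nlinarith
  · push_cast at hup hlow
    refine lt_binStart_of_three_le (by omega) hx hanti hup
      (fun i hi => (hlow i hi).trans_eq (by ring)) hu₀ ?_ hsum
    have : (r : ℝ) ≤ 4 * (r / 4 : ℕ) + 3 := by exact_mod_cast (by omega)
    nlinarith

theorem le_binStart {N r : ℕ} (hr : 2 ≤ r) (hN : 2 ≤ N) (hx : ∀ i, 0 < x i)
    (hanti : AntitoneOn x (Set.Iio N)) (hup : ∀ i, x i * minPeriod r ≤ 1)
    (hlow : 1 ≤ 2 * minPeriod r * x (N - 2)) (hu₀ : 0 < u) (hu : 1 < u * (r + 1)) (hux : u ≤ x 0)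
    (hsum : ∑ i ∈ Finset.range (N - 1), x i ≤ 3 / 4 * (1 - u) + 1 / 1000)
    (hp : p = if 1 < N * x 0 then numBins r else N) : N ≤ binStart p x p := by
  split_ifs at hp with hlt
  · obtain ⟨M, rfl⟩ : ∃ M, N = M + 1 := ⟨N - 1, by omega⟩
    subst hp
    refine lt_binStart_numBins hr hx hanti hup (fun i hi => ?_) hu₀ hu hux hsum
      (by simpa using hlt)
    have := hanti (Set.mem_Iio.mpr (by omega)) (Set.mem_Iio.mpr (by omega))
      (show i ≤ M + 1 - 2 by omega)
    nlinarith [(minPeriod r).cast_nonneg (α := ℝ)]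
  · subst hp
    refine (min_self p).ge.trans (min_le_binStart hx (fun s hs => ?_) p)
    have := hanti (Set.mem_Iio.mpr (by omega)) (Set.mem_Iio.mpr hs) s.zero_le
    nlinarith [p.cast_nonneg (α := ℝ)]

end Bins

/-! ### The schedule -/

/-- The schedule in which the bins take turns, the trees of a bin take turns in the slots of this
bin, and the slots of a tree are distributed by the binary digits of their numbers. The bins are
given by weights `x` of the trees. -/
noncomputable def treeSchedule (T : ℕ → Tree) (x : ℕ → ℝ) (p t : ℕ) : ℕ :=
  let s := binStart p x (t % p)
  let k := binCount p x s
  (T (s + t / p % k)).walk (t / p / k)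

section Schedule

variable {T : ℕ → Tree} {x g : ℕ → ℝ} {p : ℕ}

lemma treeSchedule_add_mul {j e s k : ℕ} (hs : binStart p x j = s) (hk : binCount p x s = k)
    (hj : j < p) (he : e < k) (c : ℕ) :
    treeSchedule T x p (j + p * (e + k * c)) = (T (s + e)).walk c := by
  have bin_eq : (j + p * (e + k * c)) % p = j := by
    rw [Nat.add_mul_mod_self_left, Nat.mod_eq_of_lt hj]
  have slot_eq : (j + p * (e + k * c)) / p = e + k * c := by
    rw [Nat.add_mul_div_left _ _ (by omega), Nat.div_eq_of_lt hj, zero_add]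
  simp only [treeSchedule, bin_eq, slot_eq, hs, hk]
  rw [Nat.add_mul_mod_self_left, Nat.mod_eq_of_lt he, Nat.add_mul_div_left _ _ (by omega),
    Nat.div_eq_of_lt he, zero_add]

lemma add_mul_add_mul_lt {j e p k r c : ℕ} (hj : j < p) (he : e < k) (hr : r < c) :
    j + p * (e + k * r) < p * (k * c) := by
  have slot_lt : e + k * r + 1 ≤ k * c := by nlinarith
  nlinarith

lemma exists_mod_eq (m : ℕ) {P r : ℕ} (hr : r < P) : ∃ t, m ≤ t ∧ t < m + P ∧ t % P = r := by
  have := Nat.div_add_mod m P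
  have := Nat.mod_lt m (r.zero_le.trans_lt hr)
  rcases le_or_gt (m % P) r with h | h
  · refine ⟨P * (m / P) + r, by omega, by omega, ?_⟩
    rw [Nat.mul_add_mod, Nat.mod_eq_of_lt hr]
  · refine ⟨P * (m / P + 1) + r, ?_, ?_, by rw [Nat.mul_add_mod, Nat.mod_eq_of_lt hr]⟩ <;>
      rw [mul_add] <;> omega

lemma exists_binStart_le {y : ℕ} (hy : y < binStart p x p) :
    ∃ j < p, binStart p x j ≤ y ∧ y < binStart p x (j + 1) := by
  simpa [and_left_comm] using Ico_subset_biUnion_Ico p (binStart p x) ⟨Nat.zero_le y, hy⟩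

/-- A leaf at depth `d` of a tree in a bin with `k` trees gets each `p * k * 2 ^ d`-th day. This is
at most its period, since the first tree of the bin is the heaviest one. -/
theorem exists_treeSchedule_eq {N y i : ℕ}
    (hT : AntitoneOn (fun j => (T j).weight g) (Set.Iio N))
    (hN : N ≤ binStart p (fun j => (T j).weight g) p) (hy : y < N)
    (hi : (T y).HasLeaf i) {z : ℝ} (hz : 0 < z) (hzi : z ≤ g i) (m : ℕ) :
    ∃ t, m ≤ t ∧ t < m + ⌊1 / z⌋₊ ∧ treeSchedule T (fun j => (T j).weight g) p t = i := by
  set x : ℕ → ℝ := fun j => (T j).weight g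
  obtain ⟨d, r, hr, le_weight, walk_eq⟩ := Tree.exists_walk_eq (g := g) hi
  obtain ⟨j, hj, start_le, lt_start⟩ := exists_binStart_le (hy.trans_le hN)
  rw [binStart] at lt_start
  set s := binStart p x j with hs
  set k := binCount p x s with hk
  obtain ⟨e, rfl⟩ := Nat.exists_eq_add_of_le start_le
  have he : e < k := by omega
  have z_le : 2 ^ d * z ≤ x s := by
    calc 2 ^ d * z ≤ 2 ^ d * g i := by gcongr
      _ ≤ x (s + e) := le_weight
      _ ≤ x s := hT (start_le.trans_lt hy) hy start_le
  obtain ⟨t, hmt, htm, mod_eq⟩ := exists_mod_eq m (add_mul_add_mul_lt hj he hr)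
  refine ⟨t, hmt, htm.trans_le (Nat.add_le_add_left (Nat.le_floor ?_) _), ?_⟩
  · rw [le_div_iff₀ hz]
    have x_pos : 0 < x s := lt_of_lt_of_le (by positivity) z_le
    calc ((p * (k * 2 ^ d) : ℕ) : ℝ) * z = k * (p * (2 ^ d * z)) := by push_cast; ring
      _ ≤ k * (p * x s) := by gcongr
      _ ≤ 1 := binCount_mul_le (by omega) x_pos
  · have t_eq : t = j + p * (e + k * (r + 2 ^ d * (t / (p * (k * 2 ^ d))))) := by
      conv_lhs => rw [← Nat.mod_add_div t (p * (k * 2 ^ d)), mod_eq]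
      ring
    rw [t_eq, treeSchedule_add_mul hs.symm hk.symm hj he]
    exact walk_eq _ (by rw [Nat.add_mul_mod_self_left, Nat.mod_eq_of_lt hr])

end Schedule

/-! ### The program for the next index -/

/-- A natural number as an expression. -/
abbrev Expr.num (k : ℕ) : Expr := .const k

/-- The content of cell `0` of array `a`, which serves as a variable. -/
abbrev Expr.var (a : ℕ) : Expr := .get a (.num 0)

/-- The assignment to cell `0` of array `a`. -/
abbrev Prog.set (a : ℕ) (e : Expr) : Prog := .assign a (.num 0) e

open BGT.Expr BGT.Prog

/- Array `8` holds the number of bins, arrays `12` and `13` the first positions and the numbers of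
positions of the bins, array `9` the nodes at the positions, array `11` the children of node `z` in
its cells `2 z` and `2 z + 1`, and array `15` the current day. The nodes less than `n` are leaves.
The program uses array `18` for the current node and array `17` for the remaining digits. -/

/-- Finds the root and the number of its slot for the current day. -/
def findRoot : Prog :=
  (set 16 (floor (div (var 15) (var 8)))).seq <|
  (set 4 (sub (var 15) (mul (var 8) (var 16)))).seq <|
  (set 17 (floor (div (var 16) (get 13 (var 4))))).seq <|
  set 18 (get 9 (add (get 12 (var 4)) (sub (var 16) (mul (get 13 (var 4)) (var 17)))))

/-- One step down in a tree. -/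
def walkStep : Prog :=
  (set 16 (floor (div (var 17) (num 2)))).seq <|
  (set 18 (get 11 (add (mul (num 2) (var 18)) (sub (var 17) (mul (num 2) (var 16)))))).seq <|
  set 17 (var 16)

/-- Walks down from a node to a leaf. -/
def walkLoop : Prog := whileLt (var 0) (add (var 18) (num 1)) walkStep

/-- Outputs the current node and starts the next day. -/
def finishDay : Prog := (set 2 (var 18)).seq <| set 15 (add (var 15) (num 1))

/-- The program for the next index. -/
def nextProg : Prog := findRoot.seq <| walkLoop.seq finishDay

/-- A bound for the growth of bit lengths in each loop-free part of the programs. -/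
def maxGrowth : ℕ := 10 ^ 9

/-- The tree is stored in the memory `child` with root `x`: the numbers less than `n` are leaves,
and the children of a node `z < Z` are in the cells `2 * z` and `2 * z + 1`. -/
def Tree.StoredAt (child : ℕ → ℝ) (n Z : ℕ) : Tree → ℝ → Prop
  | leaf i, x => x = i ∧ i < n
  | node l r, x => ∃ z : ℕ, x = z ∧ n ≤ z ∧ z < Z ∧ l.StoredAt child n Z (child (2 * z)) ∧
      r.StoredAt child n Z (child (2 * z + 1))

lemma floor_natCast_div_natCast (a b : ℕ) : ((⌊(a : ℝ) / b⌋ : ℤ) : ℝ) = (a / b : ℕ) := by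
  rw [← Nat.floor_div_eq_div (K := ℝ), natCast_floor_eq_intCast_floor (by positivity)]

lemma natCast_sub_mul_div (a b : ℕ) : (a : ℝ) - b * (a / b : ℕ) = (a % b : ℕ) := by
  rw [sub_eq_iff_eq_add]
  exact_mod_cast (Nat.mod_add_div a b).symm

section Walk

variable {P : ℝ → Prop} {m : Mem} {n Z c : ℕ}

lemma run_walkStep {z : ℕ} (hz : m 18 0 = z) (hc : m 17 0 = c) :
    walkStep.run m = ((m.write 16 0 (c / 2 : ℕ)).write 18 0 (m 11 (2 * z + c % 2))).write 17 0
      (c / 2 : ℕ) := by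
  have half := floor_natCast_div_natCast c 2
  have digit := natCast_sub_mul_div c 2
  have child : (2 * (z : ℝ) + (c % 2 : ℕ)) = (2 * z + c % 2 : ℕ) := by push_cast; rfl
  rw [Nat.cast_ofNat] at half digit
  simp [walkStep, Prog.run, Expr.eval, Mem.write_apply, hz, hc, half, digit, child,
    -Nat.cast_add, -Nat.cast_mul, -Nat.cast_div_charZero]

lemma Tree.StoredAt.walkLoop_guard {T : Tree} (hn : m 0 0 = n)
    (hT : T.StoredAt (m 11) n Z (m 18 0)) :
    (var 0).eval m < (add (var 18) (num 1)).eval m ↔ ∃ l r, T = .node l r := by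
  simp only [Expr.eval, Rat.cast_natCast, Nat.floor_natCast, hn]
  cases T with
  | leaf i =>
    rw [hT.1]
    norm_cast
    simp [hT.2]
  | node l r =>
    obtain ⟨z, hz, hnz, -⟩ := hT
    rw [hz]
    norm_cast
    simp [hnz]

lemma reaches_walkStep {l r : Tree} (hP : ∀ c' ≤ c, P c') (hm : ∀ a j, P (m a j))
    (hT : (Tree.node l r).StoredAt (m 11) n Z (m 18 0)) (hc : m 17 0 = c) :
    Reaches (HasGrowth P maxGrowth) walkStep m 70 fun m' =>
      (∀ a < 16, m' a = m a) ∧ (∀ a j, P (m' a j)) ∧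
      (if c % 2 = 0 then l else r).StoredAt (m 11) n Z (m' 18 0) ∧ m' 17 0 = (c / 2 : ℕ) := by
  obtain ⟨z, hz, -, -, hl, hr⟩ := hT
  have half_ok : P (c / 2 : ℕ) := hP _ (Nat.div_le_self _ _)
  refine .of_run hm ?_
  rw [run_walkStep hz hc]
  refine ⟨fun a ha => ?_, Mem.forall_write (Mem.forall_write (Mem.forall_write hm half_ok _ _)
    (hm _ _) _ _) half_ok _ _, ?_, by simp [Mem.write_apply]⟩
  · ext j
    simp only [Mem.write_apply]
    simp [show a ≠ 16 by omega, show a ≠ 17 by omega, show a ≠ 18 by omega]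
  · rcases Nat.mod_two_eq_zero_or_one c with h | h <;> simpa [Mem.write_apply, h]

lemma reaches_walkLoop {T : Tree} (hP : ∀ c' ≤ c, P c') (hm : ∀ a j, P (m a j)) (hn : m 0 0 = n)
    (hT : T.StoredAt (m 11) n Z (m 18 0)) (hc : m 17 0 = c) :
    Reaches (HasGrowth P maxGrowth) walkLoop m (80 * (T.height + 1)) fun m' =>
      (∀ a < 16, m' a = m a) ∧ (∀ a j, P (m' a j)) ∧ m' 18 0 = T.walk c := by
  refine .whileLt (fun i m' => (∀ a < 16, m' a = m a) ∧ (∀ a j, P (m' a j)) ∧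
    ∃ (T' : Tree) (c' : ℕ), T'.height ≤ i ∧ T'.StoredAt (m' 11) n Z (m' 18 0) ∧ m' 17 0 = c' ∧
      c' ≤ c ∧ T'.walk c' = T.walk c) 70 (fun i m' h => ?_) ?_ ?_
    ⟨fun _ _ => rfl, hm, T, c, le_rfl, hT, hc, le_rfl, rfl⟩ ?_
  · exact ⟨Expr.allOk_of_forall h.2.1, Expr.allOk_of_forall h.2.1⟩
  · rintro i m' ⟨frame, ok, T', c', height_le, stored, hc', c'_le, walk_eq⟩ hlt
    obtain ⟨l, r, rfl⟩ := (stored.walkLoop_guard (by rwa [frame 0 (by decide)])).mp hlt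
    simp only [Tree.height, Tree.walk] at height_le walk_eq
    have heights_le := max_le_iff.mp (Nat.le_sub_one_of_lt height_le)
    refine ⟨i - 1, by omega,
      (reaches_walkStep (fun c hc => hP c (hc.trans c'_le)) ok stored hc').mono le_rfl ?_⟩
    rintro m'' ⟨frame', ok', stored', hc''⟩
    refine ⟨fun a ha => (frame' a ha).trans (frame a ha), ok', _, c' / 2, ?_,
      frame' 11 (by decide) ▸ stored', hc'', (Nat.div_le_self _ _).trans c'_le, ?_⟩
    · split_ifs
      exacts [heights_le.1, heights_le.2]
    · rw [← walk_eq]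
      split_ifs <;> rfl
  · rintro i m' ⟨frame, ok, T', c', height_le, stored, -, -, walk_eq⟩ hle
    refine ⟨frame, ok, ?_⟩
    have not_node := (stored.walkLoop_guard (by rwa [frame 0 (by decide)])).not.mp hle.not_gt
    cases T' with
    | leaf i => rw [stored.1, ← walk_eq, Tree.walk]
    | node l r => exact absurd ⟨l, r, rfl⟩ not_node
  · rw [mul_comm]
    exact Nat.mul_le_mul_right _ (by decide)

end Walk

/-- The memory `m` represents the schedule from day `t` on: it stores `n` bamboos, the trees `T`,
the bins of the weights `x` of their roots, and only values in `P`. -/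
structure Ready (n Z p : ℕ) (T : ℕ → Tree) (x : ℕ → ℝ) (P : ℝ → Prop) (t : ℕ) (m : Mem) :
    Prop where
  mem_n : m 0 0 = n
  mem_numBins : m 8 0 = p
  mem_root : ∀ j, (T j).StoredAt (m 11) n Z (m 9 j)
  mem_start : ∀ j < p, m 12 j = binStart p x j
  mem_count : ∀ j < p, m 13 j = binCount p x (binStart p x j)
  mem_day : m 15 0 = t
  mem_ok : ∀ a j, P (m a j)

section NextIndex

variable {P : ℝ → Prop} {m : Mem} {n Z p t : ℕ} {T : ℕ → Tree} {x : ℕ → ℝ}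

lemma Ready.nextDay (h : Ready n Z p T x P t m) {P' : ℝ → Prop} {m' : Mem}
    (frame : ∀ a < 14, 5 ≤ a ∨ a = 0 → m' a = m a) (hday : m' 15 0 = (t + 1 : ℕ))
    (hok : ∀ a j, P' (m' a j)) : Ready n Z p T x P' (t + 1) m' where
  mem_n := by rw [frame 0 (by decide) (by decide), h.mem_n]
  mem_numBins := by rw [frame 8 (by decide) (by decide), h.mem_numBins]
  mem_root := by
    rw [frame 9 (by decide) (by decide), frame 11 (by decide) (by decide)]
    exact h.mem_root
  mem_start := by
    rw [frame 12 (by decide) (by decide)]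
    exact h.mem_start
  mem_count := by
    rw [frame 13 (by decide) (by decide)]
    exact h.mem_count
  mem_day := hday
  mem_ok := hok

lemma reaches_findRoot (hp : 0 < p) (hP : ∀ c ≤ t, P c) (h : Ready n Z p T x P t m) :
    Reaches (HasGrowth P maxGrowth) findRoot m 90 fun m' =>
      (∀ a < 16, a ≠ 4 → m' a = m a) ∧ (∀ a j, P (m' a j)) ∧ ∃ j c : ℕ,
        (T j).StoredAt (m 11) n Z (m' 18 0) ∧ m' 17 0 = c ∧ c ≤ t ∧
          (T j).walk c = treeSchedule T x p t := by
  set s := binStart p x (t % p) with hs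
  set k := binCount p x s with hk
  have run_eq : findRoot.run m = (((m.write 16 0 (t / p : ℕ)).write 4 0 (t % p : ℕ)).write 17 0
      (t / p / k : ℕ)).write 18 0 (m 9 (s + t / p % k)) := by
    have day := floor_natCast_div_natCast t p
    have bin := natCast_sub_mul_div t p
    have slot := floor_natCast_div_natCast (t / p) k
    have offset := natCast_sub_mul_div (t / p) k
    have position : (s : ℝ) + (t / p % k : ℕ) = (s + t / p % k : ℕ) := by push_cast; rfl
    have bin_lt := Nat.mod_lt t hp
    simp [findRoot, Prog.run, Expr.eval, Mem.write_apply, h.mem_day, h.mem_numBins, day, bin,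
      h.mem_count _ bin_lt, h.mem_start _ bin_lt, ← hs, ← hk, slot, offset, position,
      -Nat.cast_add, -Nat.cast_mul, -Nat.cast_div_charZero]
  have days_le : t / p ≤ t := Nat.div_le_self _ _
  have digits_le : t / p / k ≤ t := (Nat.div_le_self _ _).trans days_le
  refine .of_run h.mem_ok ?_
  rw [run_eq]
  refine ⟨fun a ha ha4 => ?_, ?_, s + t / p % k, t / p / k, ?_, ?_, digits_le, rfl⟩
  · ext j
    simp only [Mem.write_apply]
    simp [ha4, show a ≠ 16 by omega, show a ≠ 17 by omega, show a ≠ 18 by omega]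
  · exact Mem.forall_write (Mem.forall_write (Mem.forall_write (Mem.forall_write h.mem_ok
      (hP _ days_le) _ _) (hP _ (Nat.mod_le _ _)) _ _) (hP _ digits_le) _ _) (h.mem_ok _ _) _ _
  · simpa [Mem.write_apply] using h.mem_root _
  · simp [Mem.write_apply]

theorem reaches_nextProg {D : ℕ} (hp : 0 < p) (hP : ∀ c ≤ t + 1, P c)
    (hD : ∀ j, (T j).height ≤ D) (h : Ready n Z p T x P t m) :
    Reaches (HasGrowth P maxGrowth) nextProg m (200 * (D + 1)) fun m' =>
      Ready n Z p T x P (t + 1) m' ∧ m' 2 0 = treeSchedule T x p t := by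
  refine .seq (k₁ := 90) (k₂ := 80 * (D + 1) + 30) (by omega)
    (reaches_findRoot hp (fun c hc => hP c (hc.trans t.le_succ)) h) ?_
  rintro m₁ ⟨frame₁, ok₁, j, c, stored, hc, hct, walk_eq⟩
  refine .seq le_rfl ((reaches_walkLoop (fun c' hc' => hP c' (by omega)) ok₁
    (by rw [frame₁ 0 (by decide) (by decide), h.mem_n])
    (by rwa [frame₁ 11 (by decide) (by decide)]) hc).mono (by gcongr; exact hD j) fun _ => id) ?_
  rintro m₂ ⟨frame₂, ok₂, out⟩
  have mem_day : m₂ 15 0 = t := by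
    rw [frame₂ 15 (by decide), frame₁ 15 (by decide) (by decide), h.mem_day]
  have run_eq : finishDay.run m₂ =
      (m₂.write 2 0 (m₂ 18 0)).write 15 0 (t + 1 : ℕ) := by
    simp [finishDay, Prog.run, Expr.eval, Mem.write_apply, mem_day]
  refine .of_run ok₂ ?_
  rw [run_eq]
  refine ⟨h.nextDay (fun a ha ha' => ?_) (by simp [Mem.write_apply])
    (Mem.forall_write (Mem.forall_write ok₂ (ok₂ _ _) _ _) (hP _ le_rfl) _ _), ?_⟩
  · rw [← frame₁ a (by omega) (by omega), ← frame₂ a (by omega)]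
    ext j
    simp only [Mem.write_apply]
    simp [show a ≠ 2 by omega, show a ≠ 15 by omega]
  · simp [Mem.write_apply, out, walk_eq]

end NextIndex

/-! ### The weights of the bamboos -/

lemma inputMem_one {n : ℕ} (I : Instance n) {j : ℕ} (hj : j < n) :
    inputMem I 1 j = I.rate ⟨j, hj⟩ := by
  simp [inputMem, hj]

lemma sum_range_inputMem_one {n : ℕ} (I : Instance n) :
    ∑ j ∈ Finset.range n, inputMem I 1 j = I.H := by
  rw [Finset.sum_range]
  exact Finset.sum_congr rfl fun i _ => inputMem_one I i.2

namespace Instance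

variable {n : ℕ} (I : Instance n)

/-- The height `(1 + δ) H` up to which the bamboos may grow, for `δ = 1 / 3 + h₁ / H`. -/
noncomputable def cap : ℝ := 4 * I.H / 3 + I.h₁

lemma cap_eq : I.cap = (1 + (1 / 3 + I.h₁ / I.H)) * I.H := by
  have := I.H_pos.ne'
  rw [cap]
  field_simp
  ring

lemma cap_pos : 0 < I.cap := by
  have := I.H_pos
  have := I.h₁_pos
  unfold cap
  positivity

lemma sum_rate_div_cap : I.H / I.cap = 3 / 4 * (1 - I.h₁ / I.cap) := by
  have := I.cap_pos.ne'
  field_simp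
  rw [cap]
  ring

lemma roundedFrequencies_eq (i : Fin n) :
    roundedFrequencies I (1 / 3 + I.h₁ / I.H) i = ⌊1 / (I.rate i / I.cap)⌋₊ := by
  rw [roundedFrequencies, ← cap_eq, one_div_div]

/-- The least frequency, that of the fastest bamboo. -/
noncomputable def period₁ : ℕ := ⌊I.cap / I.h₁⌋₊

lemma two_le_period₁ : 2 ≤ I.period₁ := by
  refine Nat.le_floor ((le_div_iff₀ I.h₁_pos).mpr ?_)
  have := I.h₁_le_H
  have := I.h₁_pos
  rw [cap]
  push_cast
  linarith

lemma H_le_mul_h₁ : I.H ≤ n * I.h₁ := by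
  simpa [H] using Finset.sum_le_card_nsmul _ _ _ fun i (_ : i ∈ Finset.univ) => I.rate_le_h₁ i

lemma period₁_le : I.period₁ ≤ 2 * n + 1 := by
  refine Nat.floor_le_of_le ((div_le_iff₀ I.h₁_pos).mpr ?_)
  have := I.H_le_mul_h₁
  have := I.H_pos
  rw [cap]
  push_cast
  linarith

lemma mul_period₁_le_one : I.h₁ / I.cap * I.period₁ ≤ 1 := by
  rw [mul_comm, ← le_div_iff₀ (div_pos I.h₁_pos I.cap_pos), one_div_div]
  exact Nat.floor_le (div_pos I.cap_pos I.h₁_pos).le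

lemma one_lt_mul_period₁_add_one : 1 < I.h₁ / I.cap * (I.period₁ + 1) := by
  rw [mul_comm, ← div_lt_iff₀ (div_pos I.h₁_pos I.cap_pos), one_div_div]
  exact Nat.lt_floor_add_one _

/-- The growth rate of bamboo `j` in units of `cap`, raised to `1 / (1000 n)` in order that the
trees built by the algorithm have logarithmic height. -/
noncomputable def weight (j : ℕ) : ℝ := max (inputMem I 1 j / I.cap) (1 / (1000 * n))

lemma weight_pos (j : ℕ) : 0 < I.weight j := by
  have := I.two_le
  exact lt_max_of_lt_right (by positivity)

lemma rate_div_cap_le_weight (i : Fin n) : I.rate i / I.cap ≤ I.weight i := by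
  rw [weight, inputMem_one I i.2]
  exact le_max_left _ _

lemma antitoneOn_weight : AntitoneOn I.weight (Set.Iio n) := by
  intro i (hi : i < n) j (hj : j < n) hij
  have rate_le : inputMem I 1 j ≤ inputMem I 1 i := by
    rw [inputMem_one I hi, inputMem_one I hj]
    exact I.rate_anti hij
  exact max_le_max_right _ (div_le_div_of_nonneg_right rate_le I.cap_pos.le)

lemma weight_mul_le_one {i : ℕ} (hi : i < n) {L : ℕ} (hL : L ≤ I.period₁) : I.weight i * L ≤ 1 := by
  have hL' : (L : ℝ) ≤ I.period₁ := mod_cast hL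
  have period₁_le : (I.period₁ : ℝ) ≤ 2 * n + 1 := mod_cast I.period₁_le
  have two_le : (2 : ℝ) ≤ n := mod_cast I.two_le
  rw [weight, max_mul_of_nonneg _ _ L.cast_nonneg, inputMem_one I hi]
  refine max_le (le_trans ?_ I.mul_period₁_le_one) ?_
  · have := I.cap_pos
    have := I.h₁_pos
    gcongr
    exact I.rate_le_h₁ _
  · rw [one_div_mul_eq_div, div_le_one (by positivity)]
    linarith

lemma sum_weight_le :
    ∑ i ∈ Finset.range n, I.weight i ≤ 3 / 4 * (1 - I.h₁ / I.cap) + 1 / 1000 := by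
  have two_le : (2 : ℝ) ≤ n := mod_cast I.two_le
  calc ∑ i ∈ Finset.range n, I.weight i
      ≤ ∑ i ∈ Finset.range n, (inputMem I 1 i / I.cap + 1 / (1000 * n)) :=
        Finset.sum_le_sum fun i hi => max_le_add_of_nonneg
          (by rw [inputMem_one I (Finset.mem_range.mp hi)]
              exact (div_pos (I.rate_pos _) I.cap_pos).le) (by positivity)
    _ = I.H / I.cap + 1 / 1000 := by
        rw [Finset.sum_add_distrib, ← Finset.sum_div, sum_range_inputMem_one, Finset.sum_const,
          Finset.card_range, nsmul_eq_mul]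
        field_simp
    _ = _ := by rw [sum_rate_div_cap]

end Instance

/-- The numbers that the algorithm may have stored after `t` days. -/
inductive IsStored {n : ℕ} (I : Instance n) (t : ℕ) : ℝ → Prop
  | natCast {c : ℕ} (hc : c ≤ 1000 * n + t) : IsStored I t c
  | rate (i : Fin n) : IsStored I t (I.rate i)
  | sum {j : ℕ} (hj : j ≤ n) : IsStored I t (∑ i ∈ Finset.range j, inputMem I 1 i)
  | cap : IsStored I t I.cap
  | two_pow_mul_weight {i e : ℕ} (hi : i < n) (he : 2 ^ e * I.weight i ≤ 1) :
      IsStored I t (2 ^ e * I.weight i)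

namespace IsStored

variable {n t : ℕ} {I : Instance n}

lemma mono {t' : ℕ} {x : ℝ} (h : IsStored I t x) (htt' : t ≤ t') : IsStored I t' x := by
  cases h with
  | natCast hc => exact .natCast (hc.trans (Nat.add_le_add_left htt' _))
  | rate i => exact .rate i
  | sum hj => exact .sum hj
  | cap => exact .cap
  | two_pow_mul_weight hi he => exact .two_pow_mul_weight hi he

lemma inputMem (I : Instance n) (a j : ℕ) : IsStored I 0 (BGT.inputMem I a j) := by
  unfold BGT.inputMem
  split_ifs with h₀ h₁
  · exact .natCast (by omega)
  · exact .rate _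
  · exact_mod_cast natCast (I := I) (Nat.zero_le _)

lemma treeWeight {T : Tree} (hT : ∀ i, T.HasLeaf i → i < n) (hle : T.weight I.weight ≤ 1) :
    IsStored I t (T.weight I.weight) := by
  obtain ⟨i, hi, e, he⟩ := T.exists_weight_eq I.weight
  rw [he] at hle ⊢
  exact .two_pow_mul_weight (hT i hi) hle

end IsStored

/-! ### The preprocessing program -/

/- The preprocessing program uses array `3` for the sum of the growth rates and then for the bound
on the heights, array `4` for a counter, array `5` for the number of trees, array `6` for the next
free node, array `7` for the least period of a tree, array `10` for the weights of the nodes, and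
array `14` for the first position of the next bin. -/

/-- Adds a growth rate to array `3`. -/
def sumStep : Prog :=
  (set 3 (add (var 3) (get 1 (var 4)))).seq <| set 4 (add (var 4) (num 1))

/-- Adds up the growth rates. -/
def sumLoop : Prog := whileLt (var 4) (var 0) sumStep

/-- Computes the weight of a bamboo. -/
def weigh : Prog :=
  ifLt (div (get 1 (var 4)) (var 3)) (div (num 1) (mul (num 1000) (var 0)))
    (assign 10 (var 4) (div (num 1) (mul (num 1000) (var 0))))
    (assign 10 (var 4) (div (get 1 (var 4)) (var 3)))

/-- Makes a tree with one node. -/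
def leafStep : Prog :=
  weigh.seq <| (assign 9 (var 4) (var 4)).seq <| set 4 (add (var 4) (num 1))

/-- Makes the trees with one node. -/
def leafLoop : Prog := whileLt (var 4) (var 0) leafStep

/-- Computes `minPeriod` and `numBins` of the period of the fastest bamboo. -/
def paramProg : Prog :=
  (set 8 (floor (div (var 3) (get 1 (num 0))))).seq <|
  ifLt (var 8) (num 4) (set 7 (var 8)) <|
    ifLt (var 8) (num 12)
      ((set 7 (mul (num 2) (floor (div (var 8) (num 2))))).seq (set 8 (num 2)))
      ((set 8 (floor (div (var 8) (num 4)))).seq (set 7 (mul (num 4) (var 8))))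

/-- Computes the parameters of the forest of all trees with one node. -/
def forestProg : Prog := paramProg.seq <| (set 5 (var 0)).seq <| set 6 (var 0)

/-- The weight of the tree at position `e`. -/
def rootWeight (e : Expr) : Expr := get 10 (get 9 e)

/-- Compares a tree with the preceding one and exchanges them if they are in the wrong order. -/
def insertStep : Prog :=
  (ifLt (rootWeight (sub (var 4) (num 1))) (rootWeight (var 4))
    ((set 16 (get 9 (var 4))).seq <|
      (assign 9 (var 4) (get 9 (sub (var 4) (num 1)))).seq <|
      assign 9 (sub (var 4) (num 1)) (var 16)) skip).seq <|
  set 4 (sub (var 4) (num 1))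

/-- Moves the tree at the position in array `4` forward to its place. -/
def insertLoop : Prog := whileLt (num 0) (var 4) insertStep

/-- Merges the last two trees. -/
def mergeProg : Prog :=
  (assign 11 (mul (num 2) (var 6)) (get 9 (sub (var 5) (num 2)))).seq <|
  (assign 11 (add (mul (num 2) (var 6)) (num 1)) (get 9 (sub (var 5) (num 1)))).seq <|
  (assign 10 (var 6) (mul (num 2) (rootWeight (sub (var 5) (num 2))))).seq <|
  (assign 9 (sub (var 5) (num 2)) (var 6)).seq <|
  (set 6 (add (var 6) (num 1))).seq <|
  (set 5 (sub (var 5) (num 1))).seq <|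
  set 4 (sub (var 5) (num 1))

/-- Merges trees as long as the last two have small weights. -/
def mergeLoop : Prog :=
  whileLt (mul (mul (num 2) (var 7)) (rootWeight (sub (var 5) (num 2)))) (num 1)
    (mergeProg.seq insertLoop)

/-- Makes a bin. -/
def binStep : Prog :=
  (assign 12 (var 4) (var 14)).seq <|
  (assign 13 (var 4) (floor (div (num 1) (mul (var 8) (rootWeight (var 14)))))).seq <|
  (set 14 (add (var 14) (get 13 (var 4)))).seq <|
  set 4 (add (var 4) (num 1))

/-- Divides the positions of the trees into bins. -/
def binLoop : Prog := whileLt (var 4) (var 8) binStep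

/-- Computes the bound on the heights. -/
def capProg : Prog :=
  (set 3 (add (div (mul (num 4) (var 3)) (num 3)) (get 1 (num 0)))).seq <| set 4 (num 0)

/-- Makes as many bins as there are trees if the bins then contain one tree each. -/
def numBinsProg : Prog :=
  (ifLt (num 1) (mul (var 5) (rootWeight (num 0))) skip (set 8 (var 5))).seq <| set 4 (num 0)

/-- The preprocessing program. -/
def preprocessProg : Prog :=
  (sumLoop.seq <| capProg.seq leafLoop).seq <|
  forestProg.seq <|
  mergeLoop.seq <|
  numBinsProg.seq binLoop

lemma Reaches.countUp {P : ℝ → Prop} {m : Mem} {a N k : ℕ} {p : Prog} (J : ℕ → Mem → Prop)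
    (b : ℕ) (hJ : ∀ j m, J j m → (∀ a j, P (m a j)) ∧ m 4 0 = j ∧ m a 0 = N)
    (hbody : ∀ j m, j < N → J j m → J (j + 1) (p.run m)) (h₀ : J 0 m)
    (hk : (N + 1) * (5 + b) ≤ k) (hp : p.isLoopFree := by decide)
    (hK : p.growth ≤ maxGrowth := by decide) (hb : p.maxCost ≤ b := by decide) :
    Reaches (HasGrowth P maxGrowth) (.whileLt (var 4) (var a) p) m k (J N) := by
  have guard_iff : ∀ j m, J j m → ((var 4).eval m < (var a).eval m ↔ j < N) := fun j m h => by
    obtain ⟨-, counter, bound⟩ := hJ j m h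
    simp only [Expr.eval, Rat.cast_natCast, Nat.floor_natCast, counter, bound, Nat.cast_lt]
  refine .whileLt (fun i m => ∃ j, i + j = N ∧ J j m) b (fun i m ⟨j, _, h⟩ => ?_)
    (fun i m ⟨j, hij, h⟩ hlt => ?_) (fun i m ⟨j, hij, h⟩ hle => ?_) ⟨0, rfl, h₀⟩ hk
  · exact ⟨Expr.allOk_of_forall (hJ j m h).1,
      Expr.allOk_of_forall (hJ j m h).1 (by decide : (num 0).growth + 1 ≤ maxGrowth)⟩
  · have hj := (guard_iff j m h).mp hlt
    refine ⟨i - 1, by omega, .of_run (hJ j m h).1 ⟨j + 1, by omega, hbody j m hj h⟩ hp hK hb⟩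
  · have hj := (guard_iff j m h).not.mp hle.not_gt
    rwa [show j = N by omega] at h

section Leaves

variable {n : ℕ} {I : Instance n} {m : Mem}

lemma reaches_sumLoop :
    Reaches (HasGrowth (IsStored I 0) maxGrowth) sumLoop (inputMem I) (100 * n) fun m' =>
      (∀ a j, IsStored I 0 (m' a j)) ∧ m' 3 0 = I.H ∧
      ∀ a, a ≠ 3 → a ≠ 4 → m' a = inputMem I a := by
  have two_le := I.two_le
  refine (Reaches.countUp (fun j m => (∀ a j, IsStored I 0 (m a j)) ∧ m 4 0 = j ∧
    m 3 0 = ∑ i ∈ Finset.range j, inputMem I 1 i ∧ ∀ a, a ≠ 3 → a ≠ 4 → m a = inputMem I a)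
    20 (N := n) (fun j m ⟨ok, counter, _, frame⟩ => ⟨ok, counter, ?_⟩)
    (fun j m hj ⟨ok, counter, sum, frame⟩ => ?_)
    ⟨.inputMem I, by simp [inputMem], by simp [inputMem], fun _ _ _ => rfl⟩ le_rfl).mono ?_ ?_
  · rw [frame 0 (by decide) (by decide)]
    simp [inputMem]
  · have run_eq : sumStep.run m =
        (m.write 3 0 (∑ i ∈ Finset.range (j + 1), inputMem I 1 i)).write 4 0 (j + 1 : ℕ) := by
      simp [sumStep, Prog.run, Expr.eval, Mem.write_apply, counter, sum, frame 1,
        Finset.sum_range_succ]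
    rw [run_eq]
    refine ⟨Mem.forall_write (Mem.forall_write ok (.sum hj) _ _) (.natCast (by omega)) _ _, ?_, ?_,
      fun a h₃ h₄ => ?_⟩
    · simp [Mem.write_apply]
    · simp [Mem.write_apply]
    · rw [← frame a h₃ h₄]
      ext j
      simp [Mem.write_apply, h₃, h₄]
  · omega
  · rintro m ⟨ok, -, sum, frame⟩
    exact ⟨ok, sum.trans (sum_range_inputMem_one I), frame⟩

lemma run_weigh {j : ℕ} (hn : m 0 0 = n) (hcap : m 3 0 = I.cap) (hj : m 4 0 = j)
    (hrate : m 1 j = inputMem I 1 j) : weigh.run m = m.write 10 j (I.weight j) := by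
  rw [Instance.weight, max_def_lt, apply_ite (m.write 10 j)]
  simp [weigh, Prog.run, Expr.eval, hn, hcap, hj, hrate]

lemma reaches_leafLoop (hn : m 0 0 = n) (hrate : m 1 = inputMem I 1) (hcap : m 3 0 = I.cap)
    (hcounter : m 4 0 = 0) (hroot : ∀ j, m 9 j = 0) (hok : ∀ a j, IsStored I 0 (m a j)) :
    Reaches (HasGrowth (IsStored I 0) maxGrowth) leafLoop m (200 * n) fun m' =>
      (∀ a j, IsStored I 0 (m' a j)) ∧ (∀ i, m' 9 i = (if i < n then i else 0 : ℕ)) ∧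
      (∀ i < n, m' 10 i = I.weight i) ∧ ∀ a, a ≠ 4 → a ≠ 9 → a ≠ 10 → m' a = m a := by
  have two_le := I.two_le
  refine (Reaches.countUp (fun j m' => (∀ a j, IsStored I 0 (m' a j)) ∧ m' 4 0 = j ∧
    (∀ i, m' 9 i = (if i < j then i else 0 : ℕ)) ∧ (∀ i < j, m' 10 i = I.weight i) ∧
    ∀ a, a ≠ 4 → a ≠ 9 → a ≠ 10 → m' a = m a) 60 (N := n)
    (fun j m' ⟨ok, counter, _, _, frame⟩ => ⟨ok, counter, ?_⟩)
    (fun j m' hj ⟨ok, counter, root, weight, frame⟩ => ?_)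
    ⟨hok, by simp [hcounter], by simp [hroot], by simp, fun _ _ _ _ => rfl⟩ le_rfl).mono (by omega)
    fun m' ⟨ok, _, root, weight, frame⟩ => ⟨ok, root, weight, frame⟩
  · rw [frame 0 (by decide) (by decide) (by decide), hn]
  · have run_eq : leafStep.run m' =
        ((m'.write 10 j (I.weight j)).write 9 j j).write 4 0 (j + 1 : ℕ) := by
      rw [leafStep, Prog.run, run_weigh (I := I) (j := j) (by rw [frame 0, hn] <;> decide)
        (by rw [frame 3, hcap] <;> decide) counter (by rw [frame 1, hrate] <;> decide)]
      simp [Prog.run, Expr.eval, Mem.write_apply, counter]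
    have weight_ok : IsStored I 0 (I.weight j) := by
      have le_one : I.weight j ≤ 1 := by
        simpa using I.weight_mul_le_one hj (one_le_two.trans I.two_le_period₁)
      simpa using IsStored.two_pow_mul_weight (t := 0) (e := 0) hj (by simpa using le_one)
    rw [run_eq]
    refine ⟨Mem.forall_write (Mem.forall_write (Mem.forall_write ok weight_ok _ _)
      (.natCast (by omega)) _ _) (.natCast (by omega)) _ _, ?_, fun i => ?_, fun i hi => ?_,
      fun a h₄ h₉ h₁₀ => ?_⟩
    · simp [Mem.write_apply]
    · rcases eq_or_ne i j with rfl | hij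
      · simp [Mem.write_apply]
      · simp [Mem.write_apply, hij, root, show i < j + 1 ↔ i < j by omega]
    · rcases eq_or_ne i j with rfl | hij
      · simp [Mem.write_apply]
      · simp [Mem.write_apply, hij, weight i (by omega)]
    · rw [← frame a h₄ h₉ h₁₀]
      ext i
      simp [Mem.write_apply, h₄, h₉, h₁₀]

lemma run_paramProg (hrate : m 1 0 = I.h₁) (hcap : m 3 0 = I.cap) :
    paramProg.run m =
      (m.write 7 0 (minPeriod I.period₁ : ℕ)).write 8 0 (numBins I.period₁ : ℕ) := by
  set r := I.period₁ with hr
  have period : ((⌊I.cap / I.h₁⌋ : ℤ) : ℝ) = r := by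
    rw [hr, Instance.period₁, natCast_floor_eq_intCast_floor (div_pos I.cap_pos I.h₁_pos).le]
  have half := floor_natCast_div_natCast r 2
  have quarter := floor_natCast_div_natCast r 4
  rw [Nat.cast_ofNat] at half quarter
  have lt_four : (r : ℝ) < 4 ↔ r < 4 := by norm_cast
  have lt_twelve : (r : ℝ) < 12 ↔ r < 12 := by norm_cast
  have run_eq : paramProg.run m = if r < 4 then (m.write 8 0 r).write 7 0 r
      else if r < 12 then ((m.write 8 0 r).write 7 0 (2 * (r / 2 : ℕ))).write 8 0 2
      else ((m.write 8 0 r).write 8 0 (r / 4 : ℕ)).write 7 0 (4 * (r / 4 : ℕ)) := by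
    simp [paramProg, Prog.run, Expr.eval, Mem.write_apply, hrate, hcap, period, half, quarter,
      lt_four, lt_twelve, -Nat.cast_div_charZero]
  rw [run_eq, minPeriod, numBins]
  ext a j
  split_ifs <;> simp [Mem.write_apply] <;> grind

end Leaves

namespace Tree.StoredAt

variable {child : ℕ → ℝ} {n Z : ℕ} {T : Tree} {x : ℝ}

lemma mono (hT : T.StoredAt child n Z x) {child' : ℕ → ℝ} {Z' : ℕ}
    (hchild : ∀ c < 2 * Z, child' c = child c) (hZ : Z ≤ Z') : T.StoredAt child' n Z' x := by
  induction T generalizing x with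
  | leaf i => exact hT
  | node l r ihl ihr =>
    obtain ⟨z, hx, hnz, hzZ, hl, hr⟩ := hT
    refine ⟨z, hx, hnz, hzZ.trans_le hZ, ?_, ?_⟩
    · rw [hchild _ (by omega)]
      exact ihl hl
    · rw [hchild _ (by omega)]
      exact ihr hr

lemma floor_lt (hT : T.StoredAt child n Z x) (hnZ : n ≤ Z) : ⌊x⌋₊ < Z := by
  cases T with
  | leaf i => simpa [hT.1] using hT.2.trans_le hnZ
  | node l r =>
    obtain ⟨z, rfl, -, hzZ, -⟩ := hT
    simpa using hzZ

end Tree.StoredAt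

/-- The memory `m` stores the trees `T`, of which only the first `N` matter, with nodes less than
`Z`, the weights of these nodes, and the parameters of the instance. -/
structure StoresForest {n : ℕ} (I : Instance n) (N Z : ℕ) (T : ℕ → Tree) (m : Mem) : Prop where
  le_nodes : n ≤ Z
  nodes_add_trees : Z + N = 2 * n
  mem_n : m 0 0 = n
  mem_trees : m 5 0 = N
  mem_nodes : m 6 0 = Z
  mem_minPeriod : m 7 0 = minPeriod I.period₁
  mem_numBins : m 8 0 = numBins I.period₁
  mem_root : ∀ j, (T j).StoredAt (m 11) n Z (m 9 j)
  mem_weight : ∀ j, m 10 ⌊m 9 j⌋₊ = (T j).weight I.weight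
  mem_nextStart : m 14 0 = 0
  mem_day : m 15 0 = 0
  mem_ok : ∀ a j, IsStored I 0 (m a j)

section Merging

variable {n N Z j : ℕ} {I : Instance n} {T : ℕ → Tree} {m m' : Mem} {b E : ℝ}

lemma StoresForest.comp_perm (h : StoresForest I N Z T m) (σ : Equiv.Perm ℕ)
    (hroot : ∀ j, m' 9 j = m 9 (σ j)) (frame : ∀ a, a ≠ 4 → a ≠ 9 → a ≠ 16 → m' a = m a)
    (hok : ∀ a j, IsStored I 0 (m' a j)) : StoresForest I N Z (T ∘ σ) m' where
  le_nodes := h.le_nodes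
  nodes_add_trees := h.nodes_add_trees
  mem_n := by rw [frame 0 (by decide) (by decide) (by decide), h.mem_n]
  mem_trees := by rw [frame 5 (by decide) (by decide) (by decide), h.mem_trees]
  mem_nodes := by rw [frame 6 (by decide) (by decide) (by decide), h.mem_nodes]
  mem_minPeriod := by rw [frame 7 (by decide) (by decide) (by decide), h.mem_minPeriod]
  mem_numBins := by rw [frame 8 (by decide) (by decide) (by decide), h.mem_numBins]
  mem_root j := by
    rw [frame 11 (by decide) (by decide) (by decide), hroot]
    exact h.mem_root _
  mem_weight j := by
    rw [frame 10 (by decide) (by decide) (by decide), hroot]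
    exact h.mem_weight _
  mem_nextStart := by rw [frame 14 (by decide) (by decide) (by decide), h.mem_nextStart]
  mem_day := by rw [frame 15 (by decide) (by decide) (by decide), h.mem_day]
  mem_ok := hok

lemma reaches_insertStep (h : StoresForest I N Z T m) (hj : m 4 0 = (j + 1 : ℕ))
    (hjN : j + 1 < N) :
    Reaches (HasGrowth (IsStored I 0) maxGrowth) insertStep m 70 fun m' => m' 4 0 = j ∧
      StoresForest I N Z (T ∘ (if (T j).weight I.weight < (T (j + 1)).weight I.weight
        then Equiv.swap j (j + 1) else 1 : Equiv.Perm ℕ)) m' := by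
  have pred : ((j + 1 : ℕ) : ℝ) - 1 = j := by push_cast; ring
  have le_two_mul := h.nodes_add_trees
  have counter_ok : IsStored I 0 j := .natCast (by omega)
  have run_eq : insertStep.run m = if (T j).weight I.weight < (T (j + 1)).weight I.weight
      then (((m.write 16 0 (m 9 (j + 1))).write 9 (j + 1) (m 9 j)).write 9 j
        (m 9 (j + 1))).write 4 0 j
      else m.write 4 0 j := by
    simp only [← h.mem_weight]
    split_ifs with hlt <;>
      simp [insertStep, rootWeight, Prog.run, Expr.eval, Mem.write_apply, hj, pred, hlt,
        -Nat.cast_add]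
  refine .of_run h.mem_ok ?_
  rw [run_eq]
  split_ifs
  · refine ⟨by simp [Mem.write_apply], h.comp_perm _ (fun i => ?_) (fun a h₄ h₉ h₁₆ => ?_)
      (Mem.forall_write (Mem.forall_write (Mem.forall_write (Mem.forall_write h.mem_ok
        (h.mem_ok _ _) _ _) (h.mem_ok _ _) _ _) (h.mem_ok _ _) _ _) counter_ok _ _)⟩
    · simp only [Mem.write_apply, Equiv.swap_apply_def]
      grind
    · ext
      simp [Mem.write_apply, h₄, h₉, h₁₆]
  · refine ⟨by simp [Mem.write_apply], h.comp_perm 1 (fun i => by simp [Mem.write_apply])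
      (fun a h₄ _ _ => ?_) (Mem.forall_write h.mem_ok counter_ok _ _)⟩
    ext
    simp [Mem.write_apply, h₄]

lemma reaches_insertLoop (h : StoresForest I N Z T m) (hj : m 4 0 = j) (hjN : j < N)
    (hforest : IsForest n I.weight b E N T)
    (hT : AntitoneExcept (fun j => (T j).weight I.weight) N j) :
    Reaches (HasGrowth (IsStored I 0) maxGrowth) insertLoop m (100 * (j + 1)) fun m' =>
      ∃ T', StoresForest I N Z T' m' ∧ IsForest n I.weight b E N T' ∧
        AntitoneOn (fun j => (T' j).weight I.weight) (Set.Iio N) := by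
  refine .whileLt (fun i m' => m' 4 0 = i ∧ i < N ∧ ∃ T', StoresForest I N Z T' m' ∧
    IsForest n I.weight b E N T' ∧ AntitoneExcept (fun j => (T' j).weight I.weight) N i) 70
    (fun i m' h => ?_) ?_ ?_ ⟨hj, hjN, T, h, hforest, hT⟩ ?_
  · obtain ⟨-, -, T', stores, -⟩ := h
    exact ⟨Expr.allOk_of_forall stores.mem_ok, Expr.allOk_of_forall stores.mem_ok⟩
  · rintro i m' ⟨counter, i_lt, T', stores, forest, anti⟩ hlt
    obtain ⟨i, rfl⟩ : ∃ i', i = i' + 1 := by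
      refine Nat.exists_eq_succ_of_ne_zero fun hi => ?_
      simp [Expr.eval, counter, hi] at hlt
    refine ⟨i, rfl, (reaches_insertStep stores counter i_lt).mono le_rfl ?_⟩
    rintro m'' ⟨counter', stores'⟩
    refine ⟨counter', by omega, _, stores', ?_⟩
    split_ifs with hw
    · refine ⟨forest.comp_perm _ fun k => ?_, anti.comp_swap hw⟩
      rw [Equiv.swap_apply_def]
      split_ifs <;> omega
    · exact ⟨forest, anti.of_succ (not_lt.mp hw)⟩
  · rintro i m' ⟨counter, -, T', stores, forest, anti⟩ hle
    obtain rfl : i = 0 := by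
      simpa [Expr.eval, counter] using hle
    exact ⟨T', stores, forest, anti.antitoneOn⟩
  · change (j + 1) * 74 ≤ _
    omega

lemma run_mergeProg (h : StoresForest I (N + 2) Z T m) :
    mergeProg.run m = ((((((m.write 11 (2 * Z) (m 9 N)).write 11 (2 * Z + 1)
      (m 9 (N + 1))).write 10 Z (2 * (T N).weight I.weight)).write 9 N Z).write 6 0
      (Z + 1 : ℕ)).write 5 0 (N + 1 : ℕ)).write 4 0 N := by
  have last : ((N + 2 : ℕ) : ℝ) - 1 = (N + 1 : ℕ) := by push_cast; ring
  have penultimate : ((N + 2 : ℕ) : ℝ) - 2 = N := by push_cast; ring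
  have pred : ((N + 1 : ℕ) : ℝ) - 1 = N := by push_cast; ring
  have left_child : 2 * (Z : ℝ) = (2 * Z : ℕ) := by push_cast; rfl
  have right_child : ((2 * Z : ℕ) : ℝ) + 1 = (2 * Z + 1 : ℕ) := by push_cast; rfl
  have next_node : (Z : ℝ) + 1 = (Z + 1 : ℕ) := by push_cast; rfl
  simp [mergeProg, rootWeight, Prog.run, Expr.eval, Mem.write_apply, h.mem_trees, h.mem_nodes,
    ← h.mem_weight, last, penultimate, pred, left_child, right_child, next_node, -Nat.cast_add,
    -Nat.cast_mul]

lemma reaches_mergeProg (h : StoresForest I (N + 2) Z T m)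
    (hle : (T (N + 1)).weight I.weight ≤ (T N).weight I.weight)
    (hok : IsStored I 0 (2 * (T N).weight I.weight)) :
    Reaches (HasGrowth (IsStored I 0) maxGrowth) mergeProg m 100 fun m' => m' 4 0 = N ∧
      StoresForest I (N + 1) (Z + 1) (Function.update T N (.node (T N) (T (N + 1)))) m' := by
  have nodes_add_trees := h.nodes_add_trees
  have cell : ∀ a j, mergeProg.run m a j = _ := fun a j => by
    rw [run_mergeProg h]
  simp only [Mem.write_apply] at cell
  have child_eq : ∀ c < 2 * Z, mergeProg.run m 11 c = m 11 c := fun c hc => by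
    simp [cell, show c ≠ 2 * Z by omega, show c ≠ 2 * Z + 1 by omega]
  refine .of_run h.mem_ok ⟨by simp [cell], h.le_nodes.trans Z.le_succ, by omega,
    by simp [cell, h.mem_n], by simp [cell], by simp [cell], by simp [cell, h.mem_minPeriod],
    by simp [cell, h.mem_numBins], fun j => ?_, fun j => ?_, by simp [cell, h.mem_nextStart],
    by simp [cell, h.mem_day], fun a j => ?_⟩
  · have stored := fun j => (h.mem_root j).mono child_eq Z.le_succ
    rcases eq_or_ne j N with rfl | hj
    · rw [Function.update_self]
      exact ⟨Z, by simp [cell], h.le_nodes, Z.lt_succ_self, by simpa [cell] using stored j,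
        by simpa [cell] using stored (j + 1)⟩
    · simpa [cell, hj] using stored j
  · rcases eq_or_ne j N with rfl | hj
    · simp [cell, Tree.weight, hle]
    · have lt := (h.mem_root j).floor_lt h.le_nodes
      simp [cell, hj, lt.ne, h.mem_weight]
  · rw [cell]
    have nat_ok : ∀ c ≤ 2 * n, IsStored I 0 c := fun c hc => .natCast (by omega)
    split_ifs
    exacts [nat_ok _ (by omega), nat_ok _ (by omega), nat_ok _ (by omega), nat_ok _ (by omega), hok,
      h.mem_ok _ _, h.mem_ok _ _, h.mem_ok _ _]

lemma reaches_mergeStep {i : ℕ} (h : StoresForest I (i + 2) Z T m)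
    (hforest : IsForest n I.weight (1 / minPeriod I.period₁) E (i + 2) T)
    (hT : AntitoneOn (fun j => (T j).weight I.weight) (Set.Iio (i + 2))) (hi : 1 ≤ i)
    (hlt : 2 * minPeriod I.period₁ * (T i).weight I.weight < 1) :
    Reaches (HasGrowth (IsStored I 0) maxGrowth) (mergeProg.seq insertLoop) m (200 * n)
      fun m' => ∃ Z' T', StoresForest I (i + 1) Z' T' m' ∧
        IsForest n I.weight (1 / minPeriod I.period₁) E (i + 1) T' ∧
        AntitoneOn (fun j => (T' j).weight I.weight) (Set.Iio (i + 1)) := by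
  have le_nodes := h.le_nodes
  have nodes_add_trees := h.nodes_add_trees
  have one_le : (1 : ℝ) ≤ minPeriod I.period₁ := mod_cast minPeriod_pos I.two_le_period₁
  have pos := hforest.weight_pos (fun j _ => I.weight_pos j) i
  have two_mul_le : 2 * (T i).weight I.weight ≤ 1 / minPeriod I.period₁ := by
    rw [le_div_iff₀ (by linarith)]
    linarith
  have last_le : (T (i + 1)).weight I.weight ≤ (T i).weight I.weight :=
    hT (by simp) (by simp) i.le_succ
  have merged := hforest.merge hT hi pos.le two_mul_le
  have merged_weight : ∀ j, (Function.update T i (.node (T i) (T (i + 1))) j).weight I.weight =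
      Function.update (fun j => (T j).weight I.weight) i (2 * (T i).weight I.weight) j := by
    intro j
    rw [Function.apply_update (fun _ t => Tree.weight I.weight t), Tree.weight,
      max_eq_left last_le]
  have weight_ok : IsStored I 0 (2 * (T i).weight I.weight) := by
    have node_ok := IsStored.treeWeight (I := I) (t := 0) (merged.leaf_lt i)
      ((merged.weight_le i).trans ((div_le_one₀ (by linarith)).mpr one_le))
    rwa [merged_weight, Function.update_self] at node_ok
  refine .seq (k₁ := 100) (k₂ := 100 * (i + 1)) (by omega)
    (reaches_mergeProg h last_le weight_ok) ?_
  rintro m' ⟨counter, stores⟩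
  refine (reaches_insertLoop stores counter i.lt_succ_self merged ?_).mono le_rfl ?_
  · simp only [merged_weight]
    exact .of_antitoneOn hT _
  · rintro m'' ⟨T', stores', forest', anti'⟩
    exact ⟨_, T', stores', forest', anti'⟩

lemma reaches_mergeLoop (h : StoresForest I n n T m)
    (hforest : IsForest n I.weight (1 / minPeriod I.period₁) E n T)
    (hT : AntitoneOn (fun j => (T j).weight I.weight) (Set.Iio n))
    (h₁ : 1 ≤ 2 * minPeriod I.period₁ * I.weight 0) :
    Reaches (HasGrowth (IsStored I 0) maxGrowth) mergeLoop m (1000 * n ^ 2) fun m' =>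
      ∃ N Z T', StoresForest I N Z T' m' ∧ IsForest n I.weight (1 / minPeriod I.period₁) E N T' ∧
        AntitoneOn (fun j => (T' j).weight I.weight) (Set.Iio N) ∧
        1 ≤ 2 * minPeriod I.period₁ * (T' (N - 2)).weight I.weight := by
  have two_le := I.two_le
  have guard_iff : ∀ i Z T m, StoresForest I (i + 2) Z T m →
    ((mul (mul (num 2) (var 7)) (rootWeight (sub (var 5) (num 2)))).eval m < (num 1).eval m ↔
      2 * minPeriod I.period₁ * (T i).weight I.weight < 1) := fun i Z T m stores => by
    have penultimate : ((i + 2 : ℕ) : ℝ) - 2 = i := by push_cast; ring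
    simp [rootWeight, Expr.eval, stores.mem_minPeriod, stores.mem_trees, penultimate,
      ← stores.mem_weight, -Nat.cast_add]
  refine .whileLt (fun i m' => ∃ Z T', StoresForest I (i + 2) Z T' m' ∧
    IsForest n I.weight (1 / minPeriod I.period₁) E (i + 2) T' ∧
    AntitoneOn (fun j => (T' j).weight I.weight) (Set.Iio (i + 2))) (200 * n)
    (i := n - 2) ?_ ?_ ?_ ⟨n, T, ?_⟩ ?_
  · rintro i m' ⟨Z, T', stores, -⟩
    exact ⟨Expr.allOk_of_forall stores.mem_ok, Expr.allOk_of_forall stores.mem_ok⟩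
  · rintro i m' ⟨Z, T', stores, forest, anti⟩ hlt
    rw [guard_iff i Z T' m' stores] at hlt
    obtain ⟨i, rfl⟩ : ∃ i', i = i' + 1 := by
      refine Nat.exists_eq_succ_of_ne_zero fun hi => ?_
      have le_first := forest.le_weight_zero anti (i := 0) (by omega) (I.weight_pos 0).le
      rw [hi] at hlt
      exact absurd (h₁.trans (mul_le_mul_of_nonneg_left le_first (by positivity))) hlt.not_ge
    exact ⟨i, rfl, reaches_mergeStep stores forest anti (by omega) hlt⟩
  · rintro i m' ⟨Z, T', stores, forest, anti⟩ hle
    rw [← not_lt, guard_iff i Z T' m' stores, not_lt] at hle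
    exact ⟨i + 2, Z, T', stores, forest, anti, hle⟩
  · rw [Nat.sub_add_cancel two_le]
    exact ⟨h, hforest, hT⟩
  · change (n - 2 + 1) * (13 + 200 * n) ≤ _
    nlinarith [Nat.sub_add_cancel two_le]

end Merging

section Preprocessing

lemma binCount_le_div {p K s : ℕ} {x : ℕ → ℝ} (hp : 0 < p) (hK : 0 < K) (hx : 1 / K ≤ x s) :
    binCount p x s ≤ K / p := by
  have x_pos : 0 < x s := lt_of_lt_of_le (by positivity) hx
  refine (Nat.le_div_iff_mul_le hp).mpr (Nat.cast_le (α := ℝ) |>.mp ?_)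
  calc ((binCount p x s * p : ℕ) : ℝ) ≤ (binCount p x s * p : ℕ) * (x s * K) :=
        le_mul_of_one_le_right (Nat.cast_nonneg _) ((div_le_iff₀ (by positivity)).mp hx)
    _ = binCount p x s * (p * x s) * K := by push_cast; ring
    _ ≤ K := mul_le_of_le_one_left K.cast_nonneg (binCount_mul_le hp x_pos)

lemma binStart_le_mul_div {p K : ℕ} {x : ℕ → ℝ} (hp : 0 < p) (hK : 0 < K) (hx : ∀ s, 1 / K ≤ x s)
    (j : ℕ) : binStart p x j ≤ j * (K / p) := by
  induction j with
  | zero => simp [binStart]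
  | succ j ih =>
    rw [binStart, Nat.succ_mul]
    exact Nat.add_le_add ih (binCount_le_div hp hK (hx _))

variable {n p : ℕ} {I : Instance n} {m : Mem} {x : ℕ → ℝ}

lemma run_binStep {j s : ℕ} (hx : 0 < x s) (hcounter : m 4 0 = j) (hnext : m 14 0 = s)
    (hbins : m 8 0 = p) (hweight : m 10 ⌊m 9 s⌋₊ = x s) :
    binStep.run m = (((m.write 12 j s).write 13 j (binCount p x s)).write 14 0
      (s + binCount p x s : ℕ)).write 4 0 (j + 1 : ℕ) := by
  have count_eq : ((⌊1 / (p * x s)⌋ : ℤ) : ℝ) = binCount p x s := by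
    rw [binCount, natCast_floor_eq_intCast_floor (by positivity)]
  simp [binStep, rootWeight, Prog.run, Expr.eval, Mem.write_apply, hcounter, hnext, hbins, hweight,
    ← count_eq]

lemma forall_lt_succ_write_apply {a j : ℕ} {f : ℕ → ℝ} (h : ∀ i < j, m a i = f i) :
    ∀ i < j + 1, m.write a j (f j) a i = f i := fun i hi => by
  rcases eq_or_ne i j with rfl | hij
  · simp [Mem.write_apply]
  · simp [Mem.write_apply, hij, h i (by omega)]

lemma reaches_binLoop (hp : 0 < p) (hpn : p ≤ 1000 * n) (hx : ∀ j, 1 / (1000 * n) ≤ x j)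
    (hcounter : m 4 0 = 0) (hbins : m 8 0 = p) (hweight : ∀ j, m 10 ⌊m 9 j⌋₊ = x j)
    (hstart : m 14 0 = 0) (hok : ∀ a j, IsStored I 0 (m a j)) :
    Reaches (HasGrowth (IsStored I 0) maxGrowth) binLoop m (60 * (p + 1)) fun m' =>
      (∀ a j, IsStored I 0 (m' a j)) ∧ (∀ j < p, m' 12 j = binStart p x j) ∧
      (∀ j < p, m' 13 j = binCount p x (binStart p x j)) ∧
      ∀ a, a ≠ 4 → a ≠ 12 → a ≠ 13 → a ≠ 14 → m' a = m a := by
  have two_le := I.two_le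
  have hx' : ∀ j, 1 / ((1000 * n : ℕ) : ℝ) ≤ x j := by exact_mod_cast hx
  have x_pos : ∀ j, 0 < x j := fun j => lt_of_lt_of_le (by positivity) (hx j)
  have count_le : ∀ s, binCount p x s ≤ 1000 * n := fun s =>
    (binCount_le_div hp (by omega) (hx' s)).trans (Nat.div_le_self _ _)
  have start_le : ∀ j ≤ p, binStart p x j ≤ 1000 * n := fun j hj =>
    (binStart_le_mul_div hp (by omega) hx' j).trans
      ((Nat.mul_le_mul_right _ hj).trans (Nat.mul_div_le _ _))
  have nat_ok : ∀ c ≤ 1000 * n, IsStored I 0 c := fun c hc => .natCast (hc.trans le_self_add)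
  refine (Reaches.countUp (fun j m' => (∀ a j, IsStored I 0 (m' a j)) ∧ m' 4 0 = j ∧
    m' 14 0 = binStart p x j ∧ (∀ i < j, m' 12 i = binStart p x i) ∧
    (∀ i < j, m' 13 i = binCount p x (binStart p x i)) ∧
    ∀ a, a ≠ 4 → a ≠ 12 → a ≠ 13 → a ≠ 14 → m' a = m a) 55 (N := p)
    (fun j m' ⟨ok, counter, _, _, _, frame⟩ => ⟨ok, counter, ?_⟩)
    (fun j m' hj ⟨ok, counter, next, start, count, frame⟩ => ?_)
    ⟨hok, by simp [hcounter], by simp [hstart, binStart], by simp, by simp,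
      fun _ _ _ _ _ => rfl⟩ le_rfl).mono (by omega)
    fun m' ⟨ok, _, _, start, count, frame⟩ => ⟨ok, start, count, frame⟩
  · rw [frame 8 (by decide) (by decide) (by decide) (by decide), hbins]
  · rw [run_binStep (x_pos _) counter next
      (by rw [frame 8 (by decide) (by decide) (by decide) (by decide), hbins])
      (by rw [frame 9 (by decide) (by decide) (by decide) (by decide),
        frame 10 (by decide) (by decide) (by decide) (by decide), hweight])]
    refine ⟨Mem.forall_write (Mem.forall_write (Mem.forall_write (Mem.forall_write ok
      (nat_ok _ (start_le _ hj.le)) _ _) (nat_ok _ (count_le _)) _ _)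
      (nat_ok _ (start_le _ hj)) _ _) (.natCast (by omega)) _ _, by simp [Mem.write_apply],
      by simp [Mem.write_apply, binStart],
      by simpa [Mem.write_apply] using forall_lt_succ_write_apply start,
      by simpa [Mem.write_apply] using forall_lt_succ_write_apply count,
      fun a h₄ h₁₂ h₁₃ h₁₄ => ?_⟩
    rw [← frame a h₄ h₁₂ h₁₃ h₁₄]
    ext i
    simp [Mem.write_apply, h₄, h₁₂, h₁₃, h₁₄]

lemma reaches_leaves :
    Reaches (HasGrowth (IsStored I 0) maxGrowth) (sumLoop.seq <| capProg.seq leafLoop) (inputMem I)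
      (320 * n) fun m =>
        (∀ a j, IsStored I 0 (m a j)) ∧ m 3 0 = I.cap ∧
        (∀ i, m 9 i = (if i < n then i else 0 : ℕ)) ∧ (∀ i < n, m 10 i = I.weight i) ∧
        ∀ a, a ≠ 3 → a ≠ 4 → a ≠ 9 → a ≠ 10 → m a = inputMem I a := by
  have two_le := I.two_le
  refine .seq (k₁ := 100 * n) (k₂ := 220 * n) (by omega) reaches_sumLoop ?_
  rintro m₁ ⟨ok₁, sum₁, frame₁⟩
  have run_eq : capProg.run m₁ = (m₁.write 3 0 I.cap).write 4 0 0 := by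
    have rate : m₁ 1 0 = I.h₁ := by
      rw [frame₁ 1 (by decide) (by decide), inputMem_one I (by omega)]
      rfl
    simp [capProg, Prog.run, Expr.eval, sum₁, rate, Instance.cap]
  refine .seq (k₁ := 20) (k₂ := 200 * n) (by omega) (.of_run ok₁ (Q := (· = _)) run_eq) ?_
  rintro m₂ rfl
  have zero_ok : IsStored I 0 (0 : ℝ) := mod_cast .natCast (c := 0) (by omega)
  refine (reaches_leafLoop ?_ ?_ ?_ ?_ ?_
    (Mem.forall_write (Mem.forall_write ok₁ .cap _ _) zero_ok _ _)).mono le_rfl ?_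
  · simp [Mem.write_apply, frame₁, inputMem]
  · ext j
    simp [Mem.write_apply, frame₁]
  · simp [Mem.write_apply]
  · simp [Mem.write_apply]
  · simp [Mem.write_apply, frame₁, inputMem]
  · rintro m₃ ⟨ok₃, root₃, weight₃, frame₃⟩
    refine ⟨ok₃, ?_, root₃, weight₃, fun a h₃ h₄ h₉ h₁₀ => ?_⟩
    · rw [frame₃ 3 (by decide) (by decide) (by decide)]
      simp [Mem.write_apply]
    · rw [frame₃ a h₄ h₉ h₁₀, ← frame₁ a h₃ h₄]
      ext j
      simp [Mem.write_apply, h₃, h₄]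

lemma reaches_forestProg (hcap : m 3 0 = I.cap)
    (hroot : ∀ i, m 9 i = (if i < n then i else 0 : ℕ)) (hweight : ∀ i < n, m 10 i = I.weight i)
    (frame : ∀ a, a ≠ 3 → a ≠ 4 → a ≠ 9 → a ≠ 10 → m a = inputMem I a)
    (hok : ∀ a j, IsStored I 0 (m a j)) :
    Reaches (HasGrowth (IsStored I 0) maxGrowth) forestProg m 100
      (StoresForest I n n fun j => .leaf (if j < n then j else 0)) := by
  have two_le := I.two_le
  have rate : m 1 0 = I.h₁ := by
    rw [frame 1 (by decide) (by decide) (by decide) (by decide), inputMem_one I (by omega)]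
    rfl
  have cell : ∀ a j, forestProg.run m a j = ((((m.write 7 0 (minPeriod I.period₁ : ℕ)).write 8 0
      (numBins I.period₁ : ℕ)).write 5 0 n).write 6 0 n) a j := fun a j => by
    rw [forestProg, Prog.run, run_paramProg rate hcap]
    simp [Prog.run, Expr.eval, Mem.write_apply, frame, inputMem]
  simp only [Mem.write_apply] at cell
  have leaf_lt : ∀ j, (if j < n then j else 0) < n := fun j => by
    split_ifs <;> omega
  refine .of_run hok ⟨le_rfl, (two_mul n).symm, ?_, ?_, ?_, ?_, ?_, fun j => ?_, fun j => ?_,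
    ?_, ?_, fun a j => ?_⟩
  iterate 5 simp [cell, frame, inputMem]
  · exact ⟨by simp [cell, hroot], leaf_lt j⟩
  · simpa [cell, hroot, Tree.weight, -Nat.cast_ite] using hweight _ (leaf_lt j)
  iterate 2 simp [cell, frame, inputMem]
  · rw [cell]
    have nat_ok : ∀ c ≤ 1000 * n, IsStored I 0 c := fun c hc => .natCast (by omega)
    have := minPeriod_le I.period₁
    have := numBins_le_minPeriod I.period₁
    have := I.period₁_le
    split_ifs
    exacts [nat_ok _ (by omega), nat_ok _ (by omega), nat_ok _ (by omega), nat_ok _ (by omega),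
      hok _ _]

lemma Instance.le_binStart {N : ℕ} {T : ℕ → Tree}
    (hforest : IsForest n I.weight (1 / minPeriod I.period₁)
      (3 / 4 * (1 - I.h₁ / I.cap) + 1 / 1000) N T)
    (hT : AntitoneOn (fun j => (T j).weight I.weight) (Set.Iio N))
    (hlow : 1 ≤ 2 * minPeriod I.period₁ * (T (N - 2)).weight I.weight)
    (hp : p = if 1 < N * (T 0).weight I.weight then numBins I.period₁ else N) :
    N ≤ binStart p (fun j => (T j).weight I.weight) p := by
  have two_le := I.two_le
  obtain ⟨M, rfl⟩ := Nat.exists_eq_add_of_le' hforest.two_le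
  refine BGT.le_binStart I.two_le_period₁ hforest.two_le
    (hforest.weight_pos fun j _ => I.weight_pos j) hT (fun j => ?_) hlow
    (div_pos I.h₁_pos I.cap_pos) I.one_lt_mul_period₁_add_one ?_ hforest.sum_range_le hp
  · exact (le_div_iff₀ (mod_cast minPeriod_pos I.two_le_period₁)).mp (hforest.weight_le j)
  · exact (I.rate_div_cap_le_weight _).trans
      (hforest.le_weight_zero hT (by omega) (I.weight_pos _).le)

lemma StoresForest.run_numBinsProg {N Z : ℕ} {T : ℕ → Tree} (h : StoresForest I N Z T m)
    (hp : p = if 1 < N * (T 0).weight I.weight then numBins I.period₁ else N) :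
    numBinsProg.run m = (m.write 8 0 p).write 4 0 0 := by
  have weight₀ : m 10 ⌊m 9 0⌋₊ = (T 0).weight I.weight := h.mem_weight 0
  have bins : m.write 8 0 (numBins I.period₁) = m := by
    ext a j
    simp only [Mem.write_apply]
    grind [h.mem_numBins]
  by_cases hlt : 1 < N * (T 0).weight I.weight <;>
    simp [numBinsProg, rootWeight, Prog.run, Expr.eval, h.mem_trees, weight₀, hp, hlt, bins]

lemma reaches_bins {N Z : ℕ} {T : ℕ → Tree} (h : StoresForest I N Z T m)
    (hforest : IsForest n I.weight (1 / minPeriod I.period₁)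
      (3 / 4 * (1 - I.h₁ / I.cap) + 1 / 1000) N T)
    (hT : AntitoneOn (fun j => (T j).weight I.weight) (Set.Iio N))
    (hlow : 1 ≤ 2 * minPeriod I.period₁ * (T (N - 2)).weight I.weight) :
    Reaches (HasGrowth (IsStored I 0) maxGrowth) (numBinsProg.seq binLoop) m (200 * n) fun m' =>
      ∃ p, 0 < p ∧ N ≤ binStart p (fun j => (T j).weight I.weight) p ∧
        Ready n Z p T (fun j => (T j).weight I.weight) (IsStored I 0) 0 m' := by
  set x := fun j => (T j).weight I.weight
  set p := if 1 < N * x 0 then numBins I.period₁ else N with hp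
  have two_le := I.two_le
  have pos : 0 < p := by
    have := hforest.two_le
    have := numBins_pos I.two_le_period₁
    split_ifs at hp <;> omega
  have le : p ≤ 2 * n + 1 := by
    have := (numBins_le_minPeriod I.period₁).trans ((minPeriod_le _).trans I.period₁_le)
    have := h.nodes_add_trees
    split_ifs at hp <;> omega
  refine .seq (k₁ := 20) (k₂ := 60 * (p + 1)) (by omega)
    (.of_run h.mem_ok (Q := (· = _)) (h.run_numBinsProg hp)) ?_
  rintro m' rfl
  refine (reaches_binLoop (x := x) pos (by omega) (fun j => ?_) ?_ ?_ (fun j => ?_) ?_ ?_).mono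
    le_rfl ?_
  · exact (le_max_right _ _).trans (Tree.le_weight (I.weight_pos _).le ((T j).hasLeaf_walk 0))
  · simp [Mem.write_apply]
  · simp [Mem.write_apply]
  · simpa [Mem.write_apply] using h.mem_weight j
  · simpa [Mem.write_apply] using h.mem_nextStart
  · exact Mem.forall_write (Mem.forall_write h.mem_ok (.natCast (by omega)) _ _)
      (mod_cast .natCast (c := 0) (by omega)) _ _
  · rintro m' ⟨ok, start, count, frame⟩
    have cell : ∀ a, a ≠ 4 → a ≠ 8 → a ≠ 12 → a ≠ 13 → a ≠ 14 → m' a = m a :=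
      fun a h₄ h₈ h₁₂ h₁₃ h₁₄ => by
        rw [frame a h₄ h₁₂ h₁₃ h₁₄]
        ext j
        simp [Mem.write_apply, h₄, h₈]
    refine ⟨p, pos, Instance.le_binStart hforest hT hlow hp, ?_, ?_, ?_, start, count, ?_, ok⟩
    · simp [cell, h.mem_n]
    · simp [frame, Mem.write_apply]
    · simpa [cell] using h.mem_root
    · simp [cell, h.mem_day]

theorem reaches_preprocessProg (I : Instance n) :
    Reaches (HasGrowth (IsStored I 0) maxGrowth) preprocessProg (inputMem I) (2000 * n ^ 2)
      fun m => ∃ E N T p Z, IsForest n I.weight (1 / minPeriod I.period₁) E N T ∧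
        AntitoneOn (fun j => (T j).weight I.weight) (Set.Iio N) ∧ 0 < p ∧
        N ≤ binStart p (fun j => (T j).weight I.weight) p ∧
        Ready n Z p T (fun j => (T j).weight I.weight) (IsStored I 0) 0 m := by
  have two_le := I.two_le
  set L := minPeriod I.period₁
  have L_pos : (0 : ℝ) < L := mod_cast minPeriod_pos I.two_le_period₁
  have leaves := IsForest.leaves two_le (b := 1 / L)
    (fun i hi => (le_div_iff₀ L_pos).mpr (I.weight_mul_le_one hi (minPeriod_le _)))
    I.sum_weight_le fun i _ => (I.weight_pos i).le
  have leaves_antitone : AntitoneOn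
      (fun j => (Tree.leaf (if j < n then j else 0)).weight I.weight) (Set.Iio n) :=
    I.antitoneOn_weight.congr fun j (hj : j < n) => by simp [Tree.weight, hj]
  have le_weight_zero : 1 ≤ 2 * L * I.weight 0 := by
    have period_lt : (I.period₁ : ℝ) + 1 ≤ 2 * L := mod_cast lt_two_mul_minPeriod I.two_le_period₁
    have weight_ge := I.rate_div_cap_le_weight ⟨0, by omega⟩
    calc 1 ≤ I.h₁ / I.cap * (I.period₁ + 1) := I.one_lt_mul_period₁_add_one.le
      _ ≤ I.weight 0 * (2 * L) := by gcongr; exacts [(I.weight_pos 0).le, weight_ge]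
      _ = _ := mul_comm _ _
  refine .seq (k₁ := 320 * n) (k₂ := 1000 * n ^ 2 + 300 * n) (by nlinarith) reaches_leaves ?_
  rintro m₁ ⟨ok, cap, root, weight, frame⟩
  refine .seq (k₁ := 100) (k₂ := 1000 * n ^ 2 + 200 * n) (by omega)
    (reaches_forestProg cap root weight frame ok) fun m₂ stores => ?_
  refine .seq le_rfl (reaches_mergeLoop stores leaves leaves_antitone le_weight_zero) ?_
  rintro m₃ ⟨N, Z, T, stores, forest, anti, low⟩
  refine (reaches_bins stores forest anti low).mono le_rfl ?_
  rintro m₄ ⟨p, pos, le_start, ready⟩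
  exact ⟨_, N, T, p, Z, forest, anti, pos, le_start, ready⟩

end Preprocessing

/-! ### Bit lengths of the stored numbers -/

section InputSize

variable {n : ℕ} {I : Instance n} {q : Fin n → ℚ}

lemma le_inputSize (q : Fin n → ℚ) : n ≤ inputSize q := by
  calc n = ∑ _i : Fin n, 1 := by simp
    _ ≤ inputSize q := Finset.sum_le_sum fun i _ =>
      (Nat.size_pos.mpr (q i).den_pos).trans_le (Nat.le_add_left _ _)

lemma size_add_size_le_inputSize (q : Fin n → ℚ) (i : Fin n) :
    Nat.size (q i).num.natAbs + Nat.size (q i).den ≤ inputSize q :=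
  Finset.single_le_sum (f := fun i => Nat.size (q i).num.natAbs + Nat.size (q i).den)
    (fun _ _ => Nat.zero_le _) (Finset.mem_univ i)

lemma size_thousand_mul_le_inputSize (q : Fin n → ℚ) :
    Nat.size (1000 * n) ≤ 10 + inputSize q :=
  (size_mul_le _ _).trans
    (add_le_add (by decide) ((size_le_self n).trans (le_inputSize q)))

lemma isFrac_rate (hq : ∀ i, (q i : ℝ) = I.rate i) (i : Fin n) :
    IsFrac (inputSize q) (I.rate i) := by
  have := size_add_size_le_inputSize q i
  exact hq i ▸ .ratCast (by omega) (by omega)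

lemma isFrac_sum_rate (hq : ∀ i, (q i : ℝ) = I.rate i) (s : Finset (Fin n)) :
    IsFrac (2 * inputSize q + 1) (∑ i ∈ s, I.rate i) := by
  have rate_frac : ∀ i ∈ s,
      IsFrac (Nat.size (q i).num.natAbs + Nat.size (q i).den) (I.rate i) := fun i _ =>
    hq i ▸ .ratCast (Nat.le_add_right _ _) (Nat.le_add_left _ _)
  refine (IsFrac.sum rate_frac).mono (Nat.add_le_add_right ?_ 1)
  calc ∑ i ∈ s, (Nat.size (q i).num.natAbs + Nat.size (q i).den + 1)
      ≤ ∑ i, (Nat.size (q i).num.natAbs + Nat.size (q i).den + 1) :=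
        Finset.sum_le_sum_of_subset s.subset_univ
    _ = inputSize q + n := by simp [Finset.sum_add_distrib, inputSize]
    _ ≤ 2 * inputSize q := by linarith [le_inputSize q]

lemma isFrac_cap (hq : ∀ i, (q i : ℝ) = I.rate i) : IsFrac (3 * inputSize q + 7) I.cap := by
  have four : IsFrac 3 (4 : ℝ) := by exact_mod_cast IsFrac.natCast (k := 4) (by decide) (by decide)
  have three : IsFrac 2 (3 : ℝ) := by exact_mod_cast IsFrac.natCast (k := 3) (by decide) (by decide)
  exact (((four.mul (isFrac_sum_rate hq Finset.univ)).div three).add (isFrac_rate hq _)).mono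
    (by omega)

lemma isFrac_weight (hq : ∀ i, (q i : ℝ) = I.rate i) {i : ℕ} (hi : i < n) :
    IsFrac (4 * inputSize q + 10) (I.weight i) := by
  rw [Instance.weight, inputMem_one I hi]
  rcases max_choice (I.rate ⟨i, hi⟩ / I.cap) (1 / (1000 * n)) with h | h <;> rw [h]
  · exact ((isFrac_rate hq _).div (isFrac_cap hq)).mono (by omega)
  · rw [one_div]
    have frac := IsFrac.natCast (size_thousand_mul_le_inputSize q) (by omega)
    push_cast at frac
    exact frac.inv.mono (by omega)

lemma Instance.two_pow_le_of_mul_le (I : Instance n) {e : ℕ} {b : ℝ} (hb : 1 / (1000 * n) ≤ b)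
    (he : 2 ^ e * b ≤ 1) : 2 ^ e ≤ 1000 * n := by
  have two_le := I.two_le
  have le_one : (2 : ℝ) ^ e * (1 / (1000 * n)) ≤ 1 := le_trans (by gcongr) he
  rw [mul_one_div, div_le_one (by positivity)] at le_one
  exact_mod_cast le_one

lemma IsStored.isFrac (hq : ∀ i, (q i : ℝ) = I.rate i) {t : ℕ} {x : ℝ} (hx : IsStored I t x) :
    IsFrac (20 * (inputSize q + Nat.size t)) x := by
  have := I.two_le
  have := le_inputSize q
  have size_thousand_mul := size_thousand_mul_le_inputSize q
  cases hx with
  | natCast hc =>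
    have := (Nat.size_le_size hc).trans (size_add_le (k := 10 + inputSize q + Nat.size t)
      (by omega) (by omega))
    exact .natCast (by omega) (by omega)
  | rate i => exact (isFrac_rate hq i).mono (by omega)
  | @sum j hj =>
    rw [Finset.sum_range]
    have sum_eq := Finset.sum_map Finset.univ (Fin.castLEEmb hj) I.rate
    have mem_eq : ∀ i : Fin j, BGT.inputMem I 1 i = I.rate (Fin.castLEEmb hj i) := fun i =>
      inputMem_one I (i.2.trans_le hj)
    simp only [mem_eq, ← sum_eq]
    exact (isFrac_sum_rate hq _).mono (by omega)
  | cap => exact (isFrac_cap hq).mono (by omega)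
  | @two_pow_mul_weight i e hi he =>
    have two_pow_le := Nat.size_le_size (I.two_pow_le_of_mul_le (le_max_right _ _) he)
    have frac := (IsFrac.natCast (two_pow_le.trans size_thousand_mul) (by omega)).mul
      (isFrac_weight hq hi)
    push_cast at frac
    exact frac.mono (by omega)

lemma HasGrowth.hasBits (hq : ∀ i, (q i : ℝ) = I.rate i) {k t : ℕ} {x : ℝ}
    (hx : HasGrowth (IsStored I t) k x) : HasBits (40 * k * (inputSize q + Nat.size t)) x := by
  have := I.two_le
  have := le_inputSize q
  refine (hx (20 * (inputSize q + Nat.size t)) (by omega) fun _ => IsStored.isFrac hq).hasBits.mono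
    (le_of_eq ?_)
  ring

end InputSize

/-! ### The algorithm -/

/-- The algorithm for discrete BGT. -/
def trimming : Algorithm := ⟨preprocessProg, nextProg⟩

section Correctness

variable {n : ℕ}

lemma IsForest.height_le (I : Instance n) {b E : ℝ} {N : ℕ} {T : ℕ → Tree} (hb : b ≤ 1)
    (h : IsForest n I.weight b E N T) (j : ℕ) : (T j).height ≤ Nat.log 2 n + 10 := by
  have two_pow_le : 2 ^ (T j).height ≤ 1000 * n :=
    I.two_pow_le_of_mul_le le_rfl <| (Tree.two_pow_height_mul_le fun i _ => le_max_right _ _).trans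
      ((h.weight_le j).trans hb)
  have lt_two_pow := Nat.lt_pow_succ_log_self Nat.one_lt_two n
  refine Nat.lt_succ_iff.mp ((Nat.pow_lt_pow_iff_right Nat.one_lt_two).mp ?_)
  calc 2 ^ (T j).height ≤ 1000 * n := two_pow_le
    _ < 2 ^ 10 * 2 ^ (Nat.log 2 n + 1) := by omega
    _ = 2 ^ (Nat.log 2 n + 10 + 1) := by rw [← pow_add]; congr 1; omega

lemma exists_iterate {ok : ℕ → ℝ → Prop} {p : Prog} {J : ℕ → Mem → Prop} {b : ℕ} {f : ℕ → ℝ}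
    (step : ∀ t m, J t m → Reaches (ok (t + 1)) p m b fun m' => J (t + 1) m' ∧ m' 2 0 = f t)
    {m₀ : Mem} (hm₀ : J 0 m₀) : ∃ (m : ℕ → Mem) (k : ℕ → ℕ), m 0 = m₀ ∧
      ∀ t, Exec (ok (t + 1)) p (m t) (m (t + 1)) (k t) ∧ k t ≤ b ∧ m (t + 1) 2 0 = f t := by
  choose! next cost exec cost_le inv entry using step
  let m : ℕ → Mem := Nat.rec m₀ next
  have hm : ∀ t, J t (m t) := fun t => by
    induction t with
    | zero => exact hm₀
    | succ t ih => exact inv t _ ih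
  exact ⟨m, fun t => cost t (m t), rfl, fun t => ⟨exec t _ (hm t), cost_le t _ (hm t),
    entry t _ (hm t)⟩⟩

lemma isPinwheelSchedule_treeSchedule (I : Instance n) {b E : ℝ} {N p : ℕ} {T : ℕ → Tree}
    (forest : IsForest n I.weight b E N T)
    (anti : AntitoneOn (fun j => (T j).weight I.weight) (Set.Iio N))
    (bins : N ≤ binStart p (fun j => (T j).weight I.weight) p) {S : Schedule n}
    (hS : ∀ t, S t = treeSchedule T (fun j => (T j).weight I.weight) p t) :
    IsPinwheelSchedule (roundedFrequencies I (1 / 3 + I.h₁ / I.H)) S := by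
  intro i m
  obtain ⟨y, hy, leaf⟩ := forest.exists_hasLeaf i i.2
  obtain ⟨t, hmt, htm, entry_eq⟩ := exists_treeSchedule_eq anti bins hy leaf
    (div_pos (I.rate_pos i) I.cap_pos) (I.rate_div_cap_le_weight i) m
  exact ⟨t, hmt, I.roundedFrequencies_eq i ▸ htm, Fin.ext ((hS t).trans entry_eq)⟩

theorem exists_runs_trimming (I : Instance n) : ∃ (S : Schedule n) (k : ℕ → ℕ),
    trimming.Runs I S (fun t => HasGrowth (IsStored I t) maxGrowth) k ∧ k 0 ≤ 2000 * n ^ 2 ∧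
    (∀ t, k (t + 1) ≤ 200 * (Nat.log 2 n + 11)) ∧
    IsPinwheelSchedule (roundedFrequencies I (1 / 3 + I.h₁ / I.H)) S := by
  obtain ⟨m₀, k₀, exec₀, hk₀, E, N, T, p, Z, forest, anti, hp, bins, ready⟩ :=
    reaches_preprocessProg I
  have one_le : 1 ≤ minPeriod I.period₁ := minPeriod_pos I.two_le_period₁
  have height_le := forest.height_le I
    (div_le_one_of_le₀ (by exact_mod_cast one_le) (Nat.cast_nonneg _))
  set x := fun j => (T j).weight I.weight
  have walk_lt : ∀ t, treeSchedule T x p t < n := fun t =>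
    forest.leaf_lt _ _ (Tree.hasLeaf_walk _ _)
  obtain ⟨m, k, rfl, runs⟩ := exists_iterate
    (J := fun t => Ready n Z p T x (IsStored I t) t)
    (ok := fun t => HasGrowth (IsStored I t) maxGrowth) (f := fun t => treeSchedule T x p t)
    (fun t m hm => reaches_nextProg hp (fun c hc => .natCast (by omega)) height_le
      { hm with mem_ok := fun a j => (hm.mem_ok a j).mono t.le_succ }) ready
  exact ⟨fun t => ⟨_, walk_lt t⟩, fun | 0 => k₀ | t + 1 => k t,
    ⟨m, exec₀, fun t => ⟨(runs t).1, (runs t).2.2⟩⟩, hk₀, fun t => (runs t).2.1,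
    isPinwheelSchedule_treeSchedule I forest anti bins fun t => rfl⟩

theorem isPolynomialTime_trimming : trimming.IsPolynomialTime := by
  -- `c` is kept opaque, as evaluating a power with exponent `40 * maxGrowth` is not feasible
  obtain ⟨c, hc⟩ : ∃ c, c = 40 * maxGrowth := ⟨_, rfl⟩
  have le_c : 2200 ≤ c := by rw [hc]; decide
  refine ⟨c, fun n I => ?_⟩
  obtain ⟨S, k, runs, preprocess_le, next_le, -⟩ := exists_runs_trimming I
  refine ⟨S, k, runs.mono fun _ _ _ => trivial, preprocess_le.trans ?_,
    fun t => (next_le t).trans ?_, fun q hq => runs.mono fun t x hx => ?_⟩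
  · have := I.two_le
    exact Nat.mul_le_mul (by omega) (Nat.pow_le_pow_right (by omega) (by omega))
  · calc 200 * (Nat.log 2 n + 11) ≤ 2200 * (Nat.log 2 n + 1) := by omega
      _ ≤ c * (Nat.log 2 n + 1) ^ c := Nat.mul_le_mul le_c (Nat.le_self_pow (by omega) _)
  · refine (hx.hasBits hq).mono ?_
    rw [← hc]
    exact Nat.mul_le_mul_left _ (Nat.le_self_pow (by omega) _)

end Correctness

theorem density_roundedFrequencies_lt_three_quarters {n : ℕ} (I : Instance n) :
    density (roundedFrequencies I (1 / 3 + I.h₁ / I.H)) < 3 / 4 := by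
  have H_pos := I.H_pos
  refine (density_roundedFrequencies_lt I ?_).trans_eq ?_ <;> rw [← I.cap_eq, Instance.cap]
  · linarith
  · rw [add_sub_cancel_right]
    field_simp

end BGT

theorem mainTheorem6 :
    ∃ A : BGT.Algorithm, A.IsPolynomialTime ∧
      ∀ (n : ℕ) (I : BGT.Instance n) (S : BGT.Schedule n), A.Outputs I S →
        BGT.IsPinwheelInstance (BGT.roundedFrequencies I (1 / 3 + I.h₁ / I.H)) ∧
        BGT.density (BGT.roundedFrequencies I (1 / 3 + I.h₁ / I.H)) < 3 / 4 ∧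
        BGT.IsPinwheelSchedule (BGT.roundedFrequencies I (1 / 3 + I.h₁ / I.H)) S ∧
        BGT.MH I S ≤ ENNReal.ofReal (4 / 3 + I.h₁ / I.H) * BGT.OPT I := by
  refine ⟨BGT.trimming, BGT.isPolynomialTime_trimming, fun n I S ⟨_, outputs⟩ => ?_⟩
  obtain ⟨S', _, runs, -, -, pinwheel⟩ := BGT.exists_runs_trimming I
  obtain rfl := outputs.unique runs
  have h₁_pos := I.h₁_pos
  have H_pos := I.H_pos
  have h₁_le_H := I.h₁_le_H
  have delta_eq : 1 + (1 / 3 + I.h₁ / I.H) = 4 / 3 + I.h₁ / I.H := by ring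
  refine ⟨BGT.isPinwheelInstance_roundedFrequencies I ?_,
    BGT.density_roundedFrequencies_lt_three_quarters I, pinwheel,
    delta_eq ▸ BGT.MH_le_mul_OPT I (by positivity) pinwheel⟩
  rw [← I.cap_eq, BGT.Instance.cap]
  linarith
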